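/- Let $\mathbb{K}$ be a field of characteristic zero, let $\gamma \geq 0$ be an integer and $[\gamma] := \{1, \dots, \gamma\}$. All operads are nonsymmetric operads in the category of $\mathbb{K}$-vector spaces, with partial compositions $\circ_i$. Words on the alphabet $\{0, 1, \dots, \gamma\}$ form a set operad: the elements of arity $n$ are the words of length $n$, the unit is the word $0$, and $u \circ_i v$ is obtained from $u$ by replacing its $i$th letter $u_i$ by the word $\max(u_i, v_1) \cdots \max(u_i, v_m)$. The $\gamma$-pluriassociative operad $\mathsf{Dias}_\gamma$ is the $\mathbb{K}$-linear span of the suboperad generated by the words $\dashv_a := 0a$ and $\vdash_a := a0$, $a \in [\gamma]$. For a set $\mathfrak{G}$ of generators of arity $2$, equip $\mathbf{Free}(\mathfrak{G})(3)$ with the bilinear form such that, for all $x, y, x', y' \in \mathfrak{G}$, $\langle x \circ_i y, x' \circ_{i'} y' \rangle$ is $1$ if $x = x'$, $y = y'$, $i = i' = 1$, is $-1$ if $x = x'$, $y = y'$, $i = i' = 2$, and is $0$ otherwise; let $\mathfrak{R}^\perp$ be the annihilator of a subspace $\mathfrak{R}$ of $\mathbf{Free}(\mathfrak{G})(3)$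 for this form. If an operad $\mathcal{O}$ admits the presentation $(\mathfrak{G}, \mathfrak{R})$, that is, if $\mathcal{O}$ is isomorphic to the quotient of $\mathbf{Free}(\mathfrak{G})$ by the operadic ideal generated by $\mathfrak{R}$, its Koszul dual is the operad (unique up to isomorphism) that admits the presentation $(\mathfrak{G}, \mathfrak{R}^\perp)$. **Theorem.** Let $\mathfrak{R}_{\mathsf{Dias}_\gamma}$ be the space of the quadratic relations between the $\dashv_a$ and $\vdash_a$, that is, the kernel in arity $3$ of the canonical morphism $\mathbf{Free}(\{\dashv_a, \vdash_a : a \in [\gamma]\}) \to \mathsf{Dias}_\gamma$. Then $\mathsf{Dias}_\gamma$ is the binary quadratic operad presented by $(\{\dashv_a, \vdash_a : a \in [\gamma]\}, \mathfrak{R}_{\mathsf{Dias}_\gamma})$. Its Koszul dual $\mathsf{Dendr}_\gamma$, in which $\leftharpoonup_a$ and $\rightharpoonup_a$ denote the generators dual to $\dashv_a$ and $\vdash_a$ respectively, is the operad that admits the following presentation: it is generated by $\{\leftharpoonup_a, \rightharpoonup_a : a \in [\gamma]\}$, in arity $2$, and its space of relations $\mathfrak{R}_{\mathsf{Dendr}_\gamma}$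 is spanned by $$\leftharpoonup_a \circ_1 \rightharpoonup_{a'} - \rightharpoonup_{a'} \circ_2 \leftharpoonup_a, \qquad a, a' \in [\gamma],$$ $$\leftharpoonup_a \circ_1 \leftharpoonup_b - \leftharpoonup_a \circ_2 \rightharpoonup_b, \qquad a < b \in [\gamma],$$ $$\rightharpoonup_a \circ_1 \leftharpoonup_b - \rightharpoonup_a \circ_2 \rightharpoonup_b, \qquad a < b \in [\gamma],$$ $$\leftharpoonup_b \circ_1 \leftharpoonup_a - \leftharpoonup_a \circ_2 \leftharpoonup_b, \qquad a < b \in [\gamma],$$ $$\rightharpoonup_a \circ_1 \rightharpoonup_b - \rightharpoonup_b \circ_2 \rightharpoonup_a, \qquad a < b \in [\gamma],$$ $$\leftharpoonup_d \circ_1 \leftharpoonup_d - \sum_{c \in [d]} \left(\leftharpoonup_d \circ_2 \leftharpoonup_c + \leftharpoonup_d \circ_2 \rightharpoonup_c\right), \qquad d \in [\gamma],$$ $$\sum_{c \in [d]} \left(\rightharpoonup_d \circ_1 \rightharpoonup_c + \rightharpoonup_d \circ_1 \leftharpoonup_c\right) - \rightharpoonup_d \circ_2 \rightharpoonup_d,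 \qquad d \in [\gamma].$$ Moreover, identifying $\leftharpoonup_a$ with $\dashv_a$ and $\rightharpoonup_a$ with $\vdash_a$, one has $\mathfrak{R}_{\mathsf{Dias}_\gamma}^\perp = \mathfrak{R}_{\mathsf{Dendr}_\gamma}$. -/

import Mathlib

universe u

/-! ### Nonsymmetric operads

A nonsymmetric operad is presented through its partial compositions. Inputs are numbered from `0`,
so that `comp 0` is the partial composition `∘₁` and `comp 1` is `∘₂`. The arity `k = n + m - 1`
of a composite is a separate argument, constrained by `k + 1 = n + m`. -/

/-- A nonsymmetric operad in the category of sets, with unit `one`. -/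
structure SetOperad where
  obj : ℕ → Type
  one : obj 1
  comp : ∀ {n m k : ℕ}, Fin n → k + 1 = n + m → obj n → obj m → obj k
  one_comp : ∀ {n : ℕ} (h : n + 1 = 1 + n) (x : obj n), comp (0 : Fin 1) h one x = x
  comp_one : ∀ {n : ℕ} (i : Fin n) (h : n + 1 = n + 1) (x : obj n), comp i h x one = x
  comp_assoc : ∀ {n m p k l q : ℕ} (i : Fin n) (j : Fin m) (ij : Fin k)
    (_ : (ij : ℕ) = (i : ℕ) + (j : ℕ))
    (hk : k + 1 = n + m) (hl : l + 1 = m + p) (hq : q + 1 = k + p) (hq' : q + 1 = n + l)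
    (x : obj n) (y : obj m) (z : obj p),
    comp ij hq (comp i hk x y) z = comp i hq' x (comp j hl y z)
  comp_comm : ∀ {n m p k l q : ℕ} (i j : Fin n) (_ : i < j) (j' : Fin k) (i' : Fin l)
    (_ : (j' : ℕ) + 1 = (j : ℕ) + m) (_ : (i' : ℕ) = (i : ℕ))
    (hk : k + 1 = n + m) (hl : l + 1 = n + p) (hq : q + 1 = k + p) (hq' : q + 1 = l + m)
    (x : obj n) (y : obj m) (z : obj p),
    comp j' hq (comp i hk x y) z = comp i' hq' (comp j hl x z) y

/-- A nonsymmetric operad in the category of `K`-vector spaces, with unit `one`. -/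
structure NSOperad (K : Type u) [Field K] where
  obj : ℕ → Type u
  [addCommGroup : ∀ n, AddCommGroup (obj n)]
  [module : ∀ n, Module K (obj n)]
  one : obj 1
  comp : ∀ {n m k : ℕ}, Fin n → k + 1 = n + m → (obj n →ₗ[K] obj m →ₗ[K] obj k)
  one_comp : ∀ {n : ℕ} (h : n + 1 = 1 + n) (x : obj n), comp (0 : Fin 1) h one x = x
  comp_one : ∀ {n : ℕ} (i : Fin n) (h : n + 1 = n + 1) (x : obj n), comp i h x one = x
  comp_assoc : ∀ {n m p k l q : ℕ} (i : Fin n) (j : Fin m) (ij : Fin k)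
    (_ : (ij : ℕ) = (i : ℕ) + (j : ℕ))
    (hk : k + 1 = n + m) (hl : l + 1 = m + p) (hq : q + 1 = k + p) (hq' : q + 1 = n + l)
    (x : obj n) (y : obj m) (z : obj p),
    comp ij hq (comp i hk x y) z = comp i hq' x (comp j hl y z)
  comp_comm : ∀ {n m p k l q : ℕ} (i j : Fin n) (_ : i < j) (j' : Fin k) (i' : Fin l)
    (_ : (j' : ℕ) + 1 = (j : ℕ) + m) (_ : (i' : ℕ) = (i : ℕ))
    (hk : k + 1 = n + m) (hl : l + 1 = n + p) (hq : q + 1 = k + p) (hq' : q + 1 = l + m)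
    (x : obj n) (y : obj m) (z : obj p),
    comp j' hq (comp i hk x y) z = comp i' hq' (comp j hl x z) y

attribute [instance] NSOperad.addCommGroup NSOperad.module

/-- A morphism of nonsymmetric operads over `K`. -/
structure NSOperad.Hom {K : Type*} [Field K] (O P : NSOperad K) where
  map : ∀ n, O.obj n →ₗ[K] P.obj n
  map_one : map 1 O.one = P.one
  map_comp : ∀ {n m k : ℕ} (i : Fin n) (h : k + 1 = n + m) (x : O.obj n) (y : O.obj m),
    map k (O.comp i h x y) = P.comp i h (map n x) (map m y)

/-! ### Linear operads spanned by set operads -/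

/-- The bilinear extension of a map `f : A → B → C` to the vector spaces with bases `A`, `B`, `C`. -/
noncomputable def bilinearExtension (K : Type*) [Field K] {A B C : Type*} (f : A → B → C) :
    (A →₀ K) →ₗ[K] (B →₀ K) →ₗ[K] (C →₀ K) :=
  Finsupp.linearCombination K (fun x => Finsupp.lmapDomain K K (f x))

theorem bilinearExtension_single (K : Type*) [Field K] {A B C : Type*} (f : A → B → C)
    (x : A) (y : B) (r s : K) :
    bilinearExtension K f (Finsupp.single x r) (Finsupp.single y s) =
      Finsupp.single (f x y) (r * s) := by
  simp [bilinearExtension]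

theorem linearCombination_bilinearExtension {K : Type*} [Field K] {A B C M N P : Type*}
    [AddCommGroup M] [Module K M] [AddCommGroup N] [Module K N] [AddCommGroup P] [Module K P]
    (f : A → B → C) (c : M →ₗ[K] N →ₗ[K] P) (u : A → M) (v : B → N) (w : C → P)
    (h : ∀ x y, w (f x y) = c (u x) (v y)) (x : A →₀ K) (y : B →₀ K) :
    Finsupp.linearCombination K w (bilinearExtension K f x y) =
      c (Finsupp.linearCombination K u x) (Finsupp.linearCombination K v y) := by
  induction x using Finsupp.induction_linear with
  | zero => simp
  | add f g hf hg => simp only [map_add, LinearMap.add_apply, hf, hg]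
  | single t b =>
    induction y using Finsupp.induction_linear with
    | zero => simp
    | add f g hf hg => simp only [map_add, hf, hg]
    | single t' b' =>
      simp only [bilinearExtension_single, Finsupp.linearCombination_single, h, map_smul,
        LinearMap.smul_apply, smul_smul, mul_comm b' b]

/-- The linear operad whose component of arity `n` is the vector space with basis `S(n)`. -/
noncomputable def SetOperad.linear (S : SetOperad) (K : Type*) [Field K] : NSOperad K where
  obj n := S.obj n →₀ K
  one := Finsupp.single S.one 1
  comp i h := bilinearExtension K (S.comp i h)
  one_comp h x := by
    induction x using Finsupp.induction_linear with
    | zero => simp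
    | add f g hf hg => rw [map_add, hf, hg]
    | single a b => rw [bilinearExtension_single, S.one_comp, one_mul]
  comp_one i h x := by
    induction x using Finsupp.induction_linear with
    | zero => simp
    | add f g hf hg => rw [map_add, LinearMap.add_apply, hf, hg]
    | single a b => rw [bilinearExtension_single, S.comp_one, mul_one]
  comp_assoc i j ij hij hk hl hq hq' x y z := by
    induction x using Finsupp.induction_linear with
    | zero => simp
    | add f g hf hg => simp only [map_add, LinearMap.add_apply, hf, hg]
    | single a b =>
      induction y using Finsupp.induction_linear with
      | zero => simp
      | add f g hf hg => simp only [map_add, LinearMap.add_apply, hf, hg]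
      | single a' b' =>
        induction z using Finsupp.induction_linear with
        | zero => simp
        | add f g hf hg => simp only [map_add, hf, hg]
        | single a'' b'' =>
          simp only [bilinearExtension_single, S.comp_assoc i j ij hij hk hl hq hq', mul_assoc]
  comp_comm i j hij j' i' hj' hi' hk hl hq hq' x y z := by
    induction x using Finsupp.induction_linear with
    | zero => simp
    | add f g hf hg => simp only [map_add, LinearMap.add_apply, hf, hg]
    | single a b =>
      induction y using Finsupp.induction_linear with
      | zero => simp
      | add f g hf hg => simp only [map_add, LinearMap.add_apply, hf, hg]
      | single a' b' =>
        induction z using Finsupp.induction_linear with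
        | zero => simp
        | add f g hf hg => simp only [map_add, LinearMap.add_apply, hf, hg]
        | single a'' b'' =>
          simp only [bilinearExtension_single, S.comp_comm i j hij j' i' hj' hi' hk hl hq hq',
            mul_right_comm]

/-! ### Suboperad generated by a family of elements -/

/-- Membership in the suboperad of `S` generated by the sets `A n ⊆ S(n)`. -/
inductive SetOperad.Generated (S : SetOperad) (A : ∀ n, Set (S.obj n)) :
    ∀ n, S.obj n → Prop
  | one : SetOperad.Generated S A 1 S.one
  | gen {n : ℕ} (x : S.obj n) (hx : x ∈ A n) : SetOperad.Generated S A n x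
  | comp {n m k : ℕ} (i : Fin n) (h : k + 1 = n + m) (x : S.obj n) (y : S.obj m)
      (hx : SetOperad.Generated S A n x) (hy : SetOperad.Generated S A m y) :
      SetOperad.Generated S A k (S.comp i h x y)

/-- The suboperad of `S` generated by the sets `A n ⊆ S(n)`. -/
def SetOperad.suboperad (S : SetOperad) (A : ∀ n, Set (S.obj n)) : SetOperad where
  obj n := {x : S.obj n // S.Generated A n x}
  one := ⟨S.one, .one⟩
  comp i h x y := ⟨S.comp i h x.1 y.1, .comp i h x.1 y.1 x.2 y.2⟩
  one_comp h x := Subtype.ext (S.one_comp h x.1)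
  comp_one i h x := Subtype.ext (S.comp_one i h x.1)
  comp_assoc i j ij hij hk hl hq hq' x y z :=
    Subtype.ext (S.comp_assoc i j ij hij hk hl hq hq' x.1 y.1 z.1)
  comp_comm i j hij j' i' hj' hi' hk hl hq hq' x y z :=
    Subtype.ext (S.comp_comm i j hij j' i' hj' hi' hk hl hq hq' x.1 y.1 z.1)

/-! ### Ideals and quotients -/

/-- Membership in the operadic ideal of `P` generated by the sets `A n ⊆ P(n)`. -/
inductive NSOperad.IdealMem {K : Type*} [Field K] (P : NSOperad K) (A : ∀ n, Set (P.obj n)) :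
    ∀ n, P.obj n → Prop
  | gen {n : ℕ} (x : P.obj n) (hx : x ∈ A n) : NSOperad.IdealMem P A n x
  | zero (n : ℕ) : NSOperad.IdealMem P A n 0
  | add {n : ℕ} (x y : P.obj n) (hx : NSOperad.IdealMem P A n x)
      (hy : NSOperad.IdealMem P A n y) : NSOperad.IdealMem P A n (x + y)
  | smul {n : ℕ} (c : K) (x : P.obj n) (hx : NSOperad.IdealMem P A n x) :
      NSOperad.IdealMem P A n (c • x)
  | comp_left {n m k : ℕ} (i : Fin n) (h : k + 1 = n + m) (x : P.obj n) (y : P.obj m)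
      (hx : NSOperad.IdealMem P A n x) : NSOperad.IdealMem P A k (P.comp i h x y)
  | comp_right {n m k : ℕ} (i : Fin n) (h : k + 1 = n + m) (x : P.obj n) (y : P.obj m)
      (hy : NSOperad.IdealMem P A m y) : NSOperad.IdealMem P A k (P.comp i h x y)

/-- The arity `n` component of the operadic ideal of `P` generated by `A`. -/
def NSOperad.ideal {K : Type*} [Field K] (P : NSOperad K) (A : ∀ n, Set (P.obj n)) (n : ℕ) :
    Submodule K (P.obj n) where
  carrier := {x | P.IdealMem A n x}
  zero_mem' := .zero n
  add_mem' hx hy := .add _ _ hx hy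
  smul_mem' c _ hx := .smul c _ hx

/-- The quotient of `P` by the operadic ideal generated by `A`. -/
noncomputable def NSOperad.quotient {K : Type*} [Field K] (P : NSOperad K)
    (A : ∀ n, Set (P.obj n)) : NSOperad K where
  obj n := P.obj n ⧸ P.ideal A n
  one := (P.ideal A 1).mkQ P.one
  comp {n m k} i h :=
    (P.ideal A n).liftQ
      ((P.ideal A m).liftQ ((P.comp i h).compr₂ (P.ideal A k).mkQ).flip (by
        intro y hy
        rw [LinearMap.mem_ker]
        ext x
        exact (Submodule.Quotient.mk_eq_zero _).2 (.comp_right i h x y hy))).flip (by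
        intro x hx
        rw [LinearMap.mem_ker]
        ext y
        exact (Submodule.Quotient.mk_eq_zero _).2 (.comp_left i h x y hx))
  one_comp h x := by
    obtain ⟨x, rfl⟩ := Submodule.mkQ_surjective _ x
    exact congrArg _ (P.one_comp h x)
  comp_one i h x := by
    obtain ⟨x, rfl⟩ := Submodule.mkQ_surjective _ x
    exact congrArg _ (P.comp_one i h x)
  comp_assoc i j ij hij hk hl hq hq' x y z := by
    obtain ⟨x, rfl⟩ := Submodule.mkQ_surjective _ x
    obtain ⟨y, rfl⟩ := Submodule.mkQ_surjective _ y
    obtain ⟨z, rfl⟩ := Submodule.mkQ_surjective _ z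
    exact congrArg _ (P.comp_assoc i j ij hij hk hl hq hq' x y z)
  comp_comm i j hij j' i' hj' hi' hk hl hq hq' x y z := by
    obtain ⟨x, rfl⟩ := Submodule.mkQ_surjective _ x
    obtain ⟨y, rfl⟩ := Submodule.mkQ_surjective _ y
    obtain ⟨z, rfl⟩ := Submodule.mkQ_surjective _ z
    exact congrArg _ (P.comp_comm i j hij j' i' hj' hi' hk hl hq hq' x y z)

/-! ### The free operad on binary generators -/

/-- Planar binary trees whose internal nodes are labelled by `G`: the syntax trees on a set `G`
of generators of arity `2`. -/
inductive SyntaxTree (G : Type) : Type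
  | leaf : SyntaxTree G
  | node (g : G) (l r : SyntaxTree G) : SyntaxTree G

/-- The arity of a syntax tree. -/
def SyntaxTree.leaves {G : Type} : SyntaxTree G → ℕ
  | .leaf => 1
  | .node _ l r => l.leaves + r.leaves

/-- `t.graft i s` grafts the root of `s` onto the leaf number `i` of `t` (counted from `0`, from
left to right); only meaningful for `i < t.leaves`. -/
def SyntaxTree.graft {G : Type} : SyntaxTree G → ℕ → SyntaxTree G → SyntaxTree G
  | .leaf, _, s => s
  | .node g l r, i, s =>
    if i < l.leaves then .node g (l.graft i s) r else .node g l (r.graft (i - l.leaves) s)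

theorem SyntaxTree.leaves_pos {G : Type} (t : SyntaxTree G) : 0 < t.leaves := by
  induction t with
  | leaf => simp [leaves]
  | node g l r hl hr => simp [leaves]; omega

theorem SyntaxTree.leaves_graft {G : Type} (t s : SyntaxTree G) (i : ℕ) (hi : i < t.leaves) :
    (t.graft i s).leaves + 1 = t.leaves + s.leaves := by
  induction t generalizing i with
  | leaf => simp [leaves, graft]; omega
  | node g l r hl hr =>
    simp only [leaves] at hi
    simp only [graft]
    split_ifs with h
    · have := hl i h
      simp only [leaves]; omega
    · have := hr (i - l.leaves) (by omega)
      simp only [leaves]; omega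

theorem SyntaxTree.graft_leaf {G : Type} (t : SyntaxTree G) (i : ℕ) :
    t.graft i .leaf = t := by
  induction t generalizing i with
  | leaf => rfl
  | node g l r hl hr => simp only [graft, hl, hr, ite_self]

theorem SyntaxTree.graft_assoc {G : Type} (x y z : SyntaxTree G) (i j : ℕ)
    (hi : i < x.leaves) (hj : j < y.leaves) :
    (x.graft i y).graft (i + j) z = x.graft i (y.graft j z) := by
  induction x generalizing i with
  | leaf =>
    simp only [leaves] at hi
    have : i = 0 := by omega
    simp [graft, this]
  | node g l r hl hr =>
    simp only [leaves] at hi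
    by_cases h : i < l.leaves
    · have h1 := leaves_graft l y i h
      simp only [graft, h, if_true]
      rw [if_pos (by omega), hl i h]
    · have h1 := hr (i - l.leaves) (by omega)
      simp only [graft, h, if_false]
      rw [if_neg (by omega), ← h1]
      congr 2
      omega

theorem SyntaxTree.graft_comm {G : Type} (x y z : SyntaxTree G) (i j j' : ℕ)
    (hij : i < j) (hj : j < x.leaves) (hj' : j' + 1 = j + y.leaves) :
    (x.graft i y).graft j' z = (x.graft j z).graft i y := by
  induction x generalizing i j j' with
  | leaf => simp only [leaves] at hj; omega
  | node g l r hl hr =>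
    simp only [leaves] at hj
    have hy := y.leaves_pos
    have hz := z.leaves_pos
    by_cases h : i < l.leaves
    · have h1 := leaves_graft l y i h
      by_cases h' : j < l.leaves
      · have h2 := leaves_graft l z j h'
        simp only [graft, h, h', if_true]
        rw [if_pos (by omega), if_pos (by omega), hl i j j' hij h' hj']
      · simp only [graft, h, h', if_true, if_false]
        rw [if_neg (by omega)]
        congr 2
        omega
    · have h' : ¬ j < l.leaves := by omega
      simp only [graft, h, h', if_false]
      rw [if_neg (by omega),
        hr (i - l.leaves) (j - l.leaves) (j' - l.leaves) (by omega) (by omega) (by omega)]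

/-- The set operad of syntax trees: the unit is the leaf and partial composition is grafting. -/
def SyntaxTree.operad (G : Type) : SetOperad where
  obj n := {t : SyntaxTree G // t.leaves = n}
  one := ⟨.leaf, rfl⟩
  comp i h x y := ⟨x.1.graft i y.1, by
    have := SyntaxTree.leaves_graft x.1 y.1 i (by rw [x.2]; exact i.2)
    have := x.2
    have := y.2
    omega⟩
  one_comp h x := rfl
  comp_one i h x := Subtype.ext (SyntaxTree.graft_leaf x.1 i)
  comp_assoc i j ij hij hk hl hq hq' x y z := Subtype.ext (by
    have := SyntaxTree.graft_assoc x.1 y.1 z.1 i j (by rw [x.2]; exact i.2) (by rw [y.2]; exact j.2)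
    simpa [hij] using this)
  comp_comm i j hij j' i' hj' hi' hk hl hq hq' x y z := Subtype.ext (by
    have := SyntaxTree.graft_comm x.1 y.1 z.1 i j j' hij (by rw [x.2]; exact j.2)
      (by rw [y.2]; exact hj')
    simpa [hi'] using this)

/-- The free nonsymmetric operad on a set `G` of generators, all of arity `2`. -/
noncomputable def FreeOperad (K : Type*) [Field K] (G : Type) : NSOperad K :=
  (SyntaxTree.operad G).linear K

/-- A generator, as an element of arity `2` of the free operad. -/
noncomputable def FreeOperad.gen (K : Type*) [Field K] {G : Type} (g : G) :
    (FreeOperad K G).obj 2 :=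
  Finsupp.single (⟨.node g .leaf .leaf, rfl⟩ : {t : SyntaxTree G // t.leaves = 2}) (1 : K)

/-- The element `x ∘₁ y` of arity `3` of the free operad, for generators `x` and `y`. -/
noncomputable def FreeOperad.gen₁ (K : Type*) [Field K] {G : Type} (x y : G) :
    (FreeOperad K G).obj 3 :=
  (FreeOperad K G).comp (m := 2) (0 : Fin 2) rfl (gen K x) (gen K y)

/-- The element `x ∘₂ y` of arity `3` of the free operad, for generators `x` and `y`. -/
noncomputable def FreeOperad.gen₂ (K : Type*) [Field K] {G : Type} (x y : G) :
    (FreeOperad K G).obj 3 :=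
  (FreeOperad K G).comp (m := 2) (1 : Fin 2) rfl (gen K x) (gen K y)

/-- The value in an operad `O` of a syntax tree of arity `n`, when its nodes labelled by `g` are
interpreted as the element `a g` of `O(2)`. -/
noncomputable def SyntaxTree.eval {K : Type*} [Field K] {G : Type} (O : NSOperad K)
    (a : G → O.obj 2) : (t : SyntaxTree G) → (n : ℕ) → t.leaves = n → O.obj n
  | .leaf, _, h => h ▸ O.one
  | .node g l r, n, h =>
    O.comp (k := n) (0 : Fin (1 + r.leaves)) (by simp only [leaves] at h; omega)
      (O.comp (k := 1 + r.leaves) (1 : Fin 2) (by omega) (a g) (r.eval O a r.leaves rfl))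
      (l.eval O a l.leaves rfl)

theorem SyntaxTree.eval_congr {K : Type*} [Field K] {G : Type} (O : NSOperad K)
    (a : G → O.obj 2) {t t' : SyntaxTree G} (e : t = t') (n : ℕ) (h : t.leaves = n)
    (h' : t'.leaves = n) : t.eval O a n h = t'.eval O a n h' := by
  subst e; rfl

theorem SyntaxTree.eval_node {K : Type*} [Field K] {G : Type} (O : NSOperad K)
    (a : G → O.obj 2) (g : G) (l r : SyntaxTree G) (n p q k : ℕ)
    (hn : (SyntaxTree.node g l r).leaves = n) (hl : l.leaves = p) (hr : r.leaves = q)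
    (z : Fin k) (hz : (z : ℕ) = 0) (hk : k + 1 = 2 + q) (h : n + 1 = k + p) :
    (SyntaxTree.node g l r).eval O a n hn =
      O.comp z h (O.comp (1 : Fin 2) hk (a g) (r.eval O a q hr)) (l.eval O a p hl) := by
  subst hl hr
  obtain rfl : k = 1 + r.leaves := by omega
  obtain rfl : z = 0 := Fin.ext hz
  rfl

theorem SyntaxTree.eval_graft {K : Type*} [Field K] {G : Type} (O : NSOperad K)
    (a : G → O.obj 2) (t s : SyntaxTree G) (n m k : ℕ) (i : Fin n) (h : k + 1 = n + m)
    (ht : t.leaves = n) (hs : s.leaves = m) (hk : (t.graft i s).leaves = k) :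
    (t.graft i s).eval O a k hk = O.comp i h (t.eval O a n ht) (s.eval O a m hs) := by
  induction t generalizing n k with
  | leaf =>
    simp only [leaves] at ht
    subst ht
    obtain rfl : k = m := by omega
    obtain rfl : i = 0 := Subsingleton.elim _ _
    exact (O.one_comp h _).symm
  | node g l r hl hr =>
    have hn := ht
    simp only [leaves] at hn
    have hlp := l.leaves_pos
    have hrp := r.leaves_pos
    have hi := i.2
    rw [eval_node O a g l r n l.leaves r.leaves (1 + r.leaves) ht rfl rfl ⟨0, by omega⟩ rfl
      (by omega) (by omega)]
    by_cases hc : (i : ℕ) < l.leaves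
    · have e : (SyntaxTree.node g l r).graft i s = .node g (l.graft i s) r := by
        simp [graft, hc]
      have h1 := leaves_graft l s i hc
      have hk' := hk
      rw [e] at hk'
      rw [eval_congr O a e k hk hk',
        eval_node O a g (l.graft i s) r k (l.graft i s).leaves r.leaves (1 + r.leaves) hk' rfl rfl
          ⟨0, by omega⟩ rfl (by omega) (by simp only [leaves] at hk'; omega),
        hl l.leaves (l.graft i s).leaves ⟨i, hc⟩ (by omega) rfl rfl]
      exact (O.comp_assoc _ _ _ (by simp) _ _ _ _ _ _ _).symm
    · have e : (SyntaxTree.node g l r).graft i s = .node g l (r.graft (i - l.leaves) s) := by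
        simp [graft, hc]
      have h1 := leaves_graft r s (i - l.leaves) (by omega)
      have hk' := hk
      rw [e] at hk'
      rw [eval_congr O a e k hk hk',
        eval_node O a g l (r.graft (i - l.leaves) s) k l.leaves (r.graft (i - l.leaves) s).leaves
          (1 + (r.graft (i - l.leaves) s).leaves) hk' rfl rfl ⟨0, by omega⟩ rfl (by omega)
          (by simp only [leaves] at hk'; omega),
        hr r.leaves (r.graft (i - l.leaves) s).leaves ⟨i - l.leaves, by omega⟩ (by omega) rfl rfl,
        ← O.comp_assoc (k := 1 + r.leaves) (1 : Fin 2) ⟨i - l.leaves, by omega⟩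
          ⟨1 + (i - l.leaves), by omega⟩ (by simp) (by omega) (by omega) (by omega) (by omega)]
      exact (O.comp_comm _ _ (by simp [Fin.lt_def]) _ _ (by simp; omega) (by simp) _ _ _ _
        _ _ _).symm

/-- The universal property of the free operad: the morphism sending each generator `g` to `a g`. -/
noncomputable def FreeOperad.lift {K : Type*} [Field K] {G : Type} (O : NSOperad K)
    (a : G → O.obj 2) : (FreeOperad K G).Hom O where
  map n := Finsupp.linearCombination K
    (fun t : {t : SyntaxTree G // t.leaves = n} => t.1.eval O a n t.2)
  map_one := by
    refine (Finsupp.linearCombination_single K _ _).trans ?_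
    exact one_smul K O.one
  map_comp {n m k} i h x y :=
    linearCombination_bilinearExtension _ (O.comp i h) _ _ _
      (fun (t : {t : SyntaxTree G // t.leaves = n}) (t' : {t : SyntaxTree G // t.leaves = m}) =>
      SyntaxTree.eval_graft O a t.1 t'.1 n m k i h t.2 t'.2
        ((SyntaxTree.operad G).comp i h t t').2) x y

theorem FreeOperad.lift_gen {K : Type*} [Field K] {G : Type} (O : NSOperad K)
    (a : G → O.obj 2) (g : G) : (FreeOperad.lift O a).map 2 (FreeOperad.gen K g) = a g := by
  refine (Finsupp.linearCombination_single K _ _).trans ?_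
  rw [one_smul]
  refine (O.comp_one _ _ _).trans ?_
  exact O.comp_one _ _ _

/-! ### Binary quadratic presentations and Koszul duality -/

/-- The family of sets of relations that is `R` in arity `3` and empty in the other arities. -/
def quadraticRelations {K : Type*} [Field K] {G : Type}
    (R : Submodule K ((FreeOperad K G).obj 3)) (n : ℕ) : Set ((FreeOperad K G).obj n) :=
  {x | ∃ h : 3 = n, ∃ r ∈ R, x = h ▸ r}

/-- The binary quadratic operad presented by `(G, R)`: the quotient of the free operad on the set
`G` of binary generators by the operadic ideal generated by the subspace `R` of arity `3`. -/
noncomputable def PresentedOperad {K : Type*} [Field K] {G : Type}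
    (R : Submodule K ((FreeOperad K G).obj 3)) : NSOperad K :=
  (FreeOperad K G).quotient (quadraticRelations R)

/-- The image of a generator in the operad presented by `(G, R)`. -/
noncomputable def PresentedOperad.gen {K : Type*} [Field K] {G : Type}
    (R : Submodule K ((FreeOperad K G).obj 3)) (g : G) : (PresentedOperad R).obj 2 :=
  ((FreeOperad K G).ideal (quadraticRelations R) 2).mkQ (FreeOperad.gen K g)

/-- `O` admits the binary quadratic presentation `(G, R)`, the generator `g` being realized by the
element `a g` of `O(2)`: some isomorphism from the operad presented by `(G, R)` to `O` sends the
class of `g` to `a g` for every `g`. -/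
def IsPresentation {K : Type*} [Field K] (O : NSOperad K) {G : Type} (a : G → O.obj 2)
    (R : Submodule K ((FreeOperad K G).obj 3)) : Prop :=
  ∃ φ : (PresentedOperad R).Hom O, (∀ n, Function.Bijective (φ.map n)) ∧
    ∀ g, φ.map 2 (PresentedOperad.gen R g) = a g

/-- The space of quadratic relations satisfied in `O` by a family `a` of elements of `O(2)`: the
kernel, in arity `3`, of the canonical morphism from the free operad to `O`. -/
noncomputable def relationSpace {K : Type*} [Field K] (O : NSOperad K) {G : Type}
    (a : G → O.obj 2) : Submodule K ((FreeOperad K G).obj 3) :=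
  LinearMap.ker ((FreeOperad.lift O a).map 3)

/-- The sign of a syntax tree of arity `3`: `1` for `x ∘₁ y` and `-1` for `x ∘₂ y`. -/
def SyntaxTree.sign {G : Type} : SyntaxTree G → ℤ
  | .node _ (.node _ _ _) _ => 1
  | _ => -1

/-- The bilinear form on the vector space with basis `T` for which the elements `t` of `T` are
orthogonal and have square `σ t`. -/
noncomputable def diagonalForm (K : Type*) [Field K] {T : Type*} (σ : T → ℤ) :
    (T →₀ K) →ₗ[K] (T →₀ K) →ₗ[K] K :=
  Finsupp.linearCombination K (fun t => (σ t : K) • Finsupp.lapply t)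

open Classical in
theorem diagonalForm_single (K : Type*) [Field K] {T : Type*} (σ : T → ℤ) (s t : T) :
    diagonalForm K σ (Finsupp.single s 1) (Finsupp.single t 1) =
      if s = t then (σ s : K) else 0 := by
  simp [diagonalForm, Finsupp.single_apply, eq_comm]

/-- The scalar product on the arity `3` component of the free operad. The syntax trees of arity `3`
are orthogonal; `x ∘₁ y` has square `1` and `x ∘₂ y` has square `-1`. -/
noncomputable def scalarProduct (K : Type*) [Field K] (G : Type) :
    (FreeOperad K G).obj 3 →ₗ[K] (FreeOperad K G).obj 3 →ₗ[K] K :=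
  diagonalForm K (fun t : {t : SyntaxTree G // t.leaves = 3} => t.1.sign)

theorem FreeOperad.gen₁_eq (K : Type*) [Field K] {G : Type} (x y : G) :
    gen₁ K x y = Finsupp.single
      (⟨.node x (.node y .leaf .leaf) .leaf, rfl⟩ : {t : SyntaxTree G // t.leaves = 3}) (1 : K) := by
  refine (bilinearExtension_single K _ _ _ _ _).trans ?_
  rw [one_mul]
  rfl

theorem FreeOperad.gen₂_eq (K : Type*) [Field K] {G : Type} (x y : G) :
    gen₂ K x y = Finsupp.single
      (⟨.node x .leaf (.node y .leaf .leaf), rfl⟩ : {t : SyntaxTree G // t.leaves = 3}) (1 : K) := by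
  refine (bilinearExtension_single K _ _ _ _ _).trans ?_
  rw [one_mul]
  rfl

open Classical in
theorem scalarProduct_gen₁_gen₁ (K : Type*) [Field K] {G : Type} (x y x' y' : G) :
    scalarProduct K G (FreeOperad.gen₁ K x y) (FreeOperad.gen₁ K x' y') =
      if x = x' ∧ y = y' then 1 else 0 := by
  rw [FreeOperad.gen₁_eq, FreeOperad.gen₁_eq]
  refine (diagonalForm_single K _ _ _).trans
    (if_congr (Subtype.ext_iff.trans (by simp)) (by simp [SyntaxTree.sign]) rfl)

open Classical in
theorem scalarProduct_gen₂_gen₂ (K : Type*) [Field K] {G : Type} (x y x' y' : G) :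
    scalarProduct K G (FreeOperad.gen₂ K x y) (FreeOperad.gen₂ K x' y') =
      if x = x' ∧ y = y' then -1 else 0 := by
  rw [FreeOperad.gen₂_eq, FreeOperad.gen₂_eq]
  refine (diagonalForm_single K _ _ _).trans
    (if_congr (Subtype.ext_iff.trans (by simp)) (by simp [SyntaxTree.sign]) rfl)

theorem scalarProduct_gen₁_gen₂ (K : Type*) [Field K] {G : Type} (x y x' y' : G) :
    scalarProduct K G (FreeOperad.gen₁ K x y) (FreeOperad.gen₂ K x' y') =
      0 := by
  rw [FreeOperad.gen₁_eq, FreeOperad.gen₂_eq]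
  refine (diagonalForm_single K _ _ _).trans (if_neg (fun h => ?_))
  simpa using Subtype.ext_iff.1 h

theorem scalarProduct_gen₂_gen₁ (K : Type*) [Field K] {G : Type} (x y x' y' : G) :
    scalarProduct K G (FreeOperad.gen₂ K x y) (FreeOperad.gen₁ K x' y') =
      0 := by
  rw [FreeOperad.gen₂_eq, FreeOperad.gen₁_eq]
  refine (diagonalForm_single K _ _ _).trans (if_neg (fun h => ?_))
  simpa using Subtype.ext_iff.1 h

/-- The annihilator of a space `R` of quadratic relations for the scalar product. -/
noncomputable def annihilator {K : Type*} [Field K] {G : Type}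
    (R : Submodule K ((FreeOperad K G).obj 3)) : Submodule K ((FreeOperad K G).obj 3) where
  carrier := {x | ∀ r ∈ R, scalarProduct K G r x = 0}
  zero_mem' := fun r _ => map_zero _
  add_mem' hx hy := fun r hr => by rw [map_add, hx r hr, hy r hr, add_zero]
  smul_mem' c x hx := fun r hr => by rw [map_smul, hx r hr, smul_zero]

/-- Koszul duality between binary quadratic operads `O` and `P`, with respect to generators `a g` of
`O` and `b g` of `P` indexed by the same set `G`: for some space `R` of quadratic relations, `O`
admits the presentation `(G, R)` on the `a g`, and `P` admits the presentation `(G, R^⊥)` on the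
`b g`. -/
def IsKoszulDual {K : Type*} [Field K] {G : Type} (O : NSOperad K) (a : G → O.obj 2)
    (P : NSOperad K) (b : G → P.obj 2) : Prop :=
  ∃ R : Submodule K ((FreeOperad K G).obj 3),
    IsPresentation O a R ∧ IsPresentation P b (annihilator R)

/-! ### The pluriassociative operad -/

/-- The partial composition of two words on the alphabet `{0, 1, …, γ}`: the letter `u i` is replaced
by the word `v` in which every letter `c` is changed into `max (u i) c`. -/
def wordComp {γ n m k : ℕ} (i : Fin n) (h : k + 1 = n + m) (u : Fin n → Fin (γ + 1))
    (v : Fin m → Fin (γ + 1)) : Fin k → Fin (γ + 1) := fun j =>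
  if h₁ : (j : ℕ) < i then u ⟨j, by omega⟩
  else if h₂ : (j : ℕ) < i + m then max (u i) (v ⟨j - i, by omega⟩)
  else u ⟨j + 1 - m, by omega⟩

/-- The set operad of words on the alphabet `{0, 1, …, γ}`, obtained from the monoid
`({0, 1, …, γ}, max, 0)`: the elements of arity `n` are the words of length `n`, and the unit is
the word `0`. -/
def wordOperad (γ : ℕ) : SetOperad where
  obj n := Fin n → Fin (γ + 1)
  one := fun _ => 0
  comp := wordComp
  one_comp {n} h x := by
    funext j
    have hj := j.2
    simp [wordComp]
  comp_one {n} i h x := by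
    funext j
    simp only [wordComp]
    split_ifs with h₁ h₂
    · rfl
    · have : j = i := Fin.ext (by omega)
      simp [this]
    · rfl
  comp_assoc {n m p k l q} i j ij hij hk hl hq hq' x y z := by
    funext t
    have hi := i.2
    have hj := j.2
    have ht := t.2
    simp only [wordComp]
    grind
  comp_comm {n m p k l q} i j hij j' i' hj' hi' hk hl hq hq' x y z := by
    funext t
    have hi := i.2
    have hj := j.2
    have ht := t.2
    simp only [wordComp]
    grind

/-- The indices of the generators of the two operads below: for `a ∈ {1, …, γ}`, encoded as the
element `a - 1` of `Fin γ`, `left a` is the index of `⊣ₐ` and `↼ₐ`, and `right a` is the index of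
`⊢ₐ` and `⇀ₐ`. -/
inductive PolyGen (γ : ℕ) : Type
  | left (a : Fin γ) : PolyGen γ
  | right (a : Fin γ) : PolyGen γ

/-- The words `⊣ₐ = 0 a` and `⊢ₐ = a 0`; `a` is encoded by `a - 1`, so the letter `a` is `a.succ`. -/
def PolyGen.word {γ : ℕ} : PolyGen γ → (wordOperad γ).obj 2
  | .left a => ![0, a.succ]
  | .right a => ![a.succ, 0]

/-- The generating sets of `Dias_γ`: the words `0 a` and `a 0`, all of arity `2`. -/
def diasGenerators (γ n : ℕ) : Set ((wordOperad γ).obj n) :=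
  {w | ∃ (h : 2 = n) (g : PolyGen γ), w = h ▸ g.word}

/-- The `γ`-pluriassociative operad: the linear span of the suboperad of words on `{0, 1, …, γ}`
generated by the words `0 a` and `a 0` for `a ∈ {1, …, γ}`. -/
noncomputable def Dias (K : Type*) [Field K] (γ : ℕ) : NSOperad K :=
  ((wordOperad γ).suboperad (diasGenerators γ)).linear K

/-- The generators `⊣ₐ` and `⊢ₐ` of the `γ`-pluriassociative operad. -/
noncomputable def Dias.gen (K : Type*) [Field K] {γ : ℕ} (g : PolyGen γ) : (Dias K γ).obj 2 :=
  Finsupp.single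
    (⟨g.word, .gen _ ⟨rfl, g, rfl⟩⟩ : ((wordOperad γ).suboperad (diasGenerators γ)).obj 2) (1 : K)

/-! ### The relations of the polydendriform operad -/

open FreeOperad PolyGen in
/-- The space of relations of the `γ`-polydendriform operad, in the free operad on the generators
`↼ₐ = left a` and `⇀ₐ = right a`; here `gen₁ K x y` is `x ∘₁ y` and `gen₂ K x y` is `x ∘₂ y`. -/
noncomputable def dendrRelations (K : Type*) [Field K] (γ : ℕ) :
    Submodule K ((FreeOperad K (PolyGen γ)).obj 3) :=
  Submodule.span K
    ({r | ∃ a a' : Fin γ, r = gen₁ K (left a) (right a') - gen₂ K (right a') (left a)} ∪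
     {r | ∃ a b : Fin γ, a < b ∧ r = gen₁ K (left a) (left b) - gen₂ K (left a) (right b)} ∪
     {r | ∃ a b : Fin γ, a < b ∧ r = gen₁ K (right a) (left b) - gen₂ K (right a) (right b)} ∪
     {r | ∃ a b : Fin γ, a < b ∧ r = gen₁ K (left b) (left a) - gen₂ K (left a) (left b)} ∪
     {r | ∃ a b : Fin γ, a < b ∧ r = gen₁ K (right a) (right b) - gen₂ K (right b) (right a)} ∪
     {r | ∃ d : Fin γ, r = gen₁ K (left d) (left d) -
        ∑ c ∈ Finset.Iic d, (gen₂ K (left d) (left c) + gen₂ K (left d) (right c))} ∪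
     {r | ∃ d : Fin γ, r =
        ∑ c ∈ Finset.Iic d, (gen₁ K (right d) (right c) + gen₁ K (right d) (left c)) -
          gen₂ K (right d) (right d)})

/-!
The operad `Dias_γ` has a basis of words, and a syntax tree on its generators takes as value in it
a single word, `SyntaxTree.code`, with exactly one letter `0`.

*Presentation.* The words of arity `3` give enough quadratic relations to turn every tree into a
double comb: a node `⊣ₐ` absorbs its right subtree, letter by letter, into a left comb
(`Dias.Congr.exists_node_left`), a node `⊢ₐ` absorbs its left subtree into a right comb
(`Dias.Congr.exists_node_right`), and the two kinds of combs commute. The double comb obtained is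
read off the word `x₁ … xₚ 0 y₁ … y_q` of the tree (`Dias.Congr.exists_normalForm`), so trees with
the same word are congruent modulo the quadratic relations (`Dias.Congr.of_code_eq`). Hence the
projection modulo these relations factors through the words, and the quadratic relations generate
all of them (`Dias.ker_lift_le`).

*Koszul dual.* Each relation of the polydendriform operad is the signed sum of the trees of arity
`3` having some given word `w`, the sign being the square of the tree for the scalar product. The
pairing with it is therefore the coefficient of `w` in the value in `Dias_γ` (`IsWordFunctional`).
All words of arity `3` occur, so the annihilator of the polydendriform relations is the space of
quadratic relations of `Dias_γ` (`annihilator_dendrRelations`); the form being nondegenerate on a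
space of finite dimension, taking annihilators again gives the stated equality.

An ideal generated in arity `3` adds nothing to its generators in that arity, so the space of
relations of a binary quadratic presentation is determined by the operad and its generators
(`IsPresentation.eq_relationSpace`). The Koszul dual thus has no other relations.
-/

/-! ### Morphisms out of the free operad and out of a quotient -/

/-- The syntax tree `t` of arity `n`, as a basis element of the free operad. -/
noncomputable def SyntaxTree.toFree (K : Type*) [Field K] {G : Type} (t : SyntaxTree G) (n : ℕ)
    (h : t.leaves = n) : (FreeOperad K G).obj n :=
  Finsupp.single (⟨t, h⟩ : {t : SyntaxTree G // t.leaves = n}) (1 : K)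

theorem FreeOperad.lift_toFree {K : Type*} [Field K] {G : Type} (O : NSOperad K)
    (a : G → O.obj 2) (t : SyntaxTree G) (n : ℕ) (h : t.leaves = n) :
    (FreeOperad.lift O a).map n (t.toFree K n h) = t.eval O a n h :=
  (Finsupp.linearCombination_single K _ _).trans (one_smul K _)

theorem FreeOperad.hom_ext_obj {K : Type*} [Field K] {G : Type} {M : Type*} [AddCommGroup M]
    [Module K M] {n : ℕ} {f f' : (FreeOperad K G).obj n →ₗ[K] M}
    (h : ∀ (t : SyntaxTree G) (ht : t.leaves = n), f (t.toFree K n ht) = f' (t.toFree K n ht)) :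
    f = f' :=
  Finsupp.lhom_ext' fun t => LinearMap.ext_ring (h t.1 t.2)

theorem SyntaxTree.toFree_eq_eval (K : Type*) [Field K] {G : Type} (t : SyntaxTree G) (n : ℕ)
    (h : t.leaves = n) :
    t.toFree K n h = t.eval (FreeOperad K G) (FreeOperad.gen K) n h := by
  induction t generalizing n with
  | leaf => simp only [leaves] at h; subst h; rfl
  | node g l r hl hr =>
    have hn := h
    simp only [leaves] at hn
    rw [eval_node _ _ g l r n l.leaves r.leaves (1 + r.leaves) h rfl rfl ⟨0, by omega⟩ rfl
      (by omega) (by omega), ← hl l.leaves rfl, ← hr r.leaves rfl]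
    refine Eq.trans ?_ (congrArg (fun z => (FreeOperad K G).comp _ _ z (l.toFree K l.leaves rfl))
      (bilinearExtension_single K _ _ _ _ _)).symm
    refine Eq.trans ?_ (bilinearExtension_single K _ _ _ _ _).symm
    simp only [mul_one]
    rfl

theorem NSOperad.Hom.map_eval {K : Type*} [Field K] {G : Type} {O P : NSOperad K}
    (ψ : O.Hom P) (a : G → O.obj 2) (t : SyntaxTree G) (n : ℕ) (h : t.leaves = n) :
    ψ.map n (t.eval O a n h) = t.eval P (fun g => ψ.map 2 (a g)) n h := by
  induction t generalizing n with
  | leaf => simp only [SyntaxTree.leaves] at h; subst h; exact ψ.map_one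
  | node g l r hl hr =>
    have hn := h
    simp only [SyntaxTree.leaves] at hn
    rw [SyntaxTree.eval_node _ _ g l r n l.leaves r.leaves (1 + r.leaves) h rfl rfl ⟨0, by omega⟩
      rfl (by omega) (by omega), SyntaxTree.eval_node _ _ g l r n l.leaves r.leaves (1 + r.leaves) h
      rfl rfl ⟨0, by omega⟩ rfl (by omega) (by omega), ψ.map_comp, ψ.map_comp, hl, hr]

/-- A morphism out of the free operad is determined by its values on the generators. -/
theorem FreeOperad.hom_eq_lift {K : Type*} [Field K] {G : Type} {O : NSOperad K}
    (ψ : (FreeOperad K G).Hom O) (n : ℕ) :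
    ψ.map n = (FreeOperad.lift O (fun g => ψ.map 2 (FreeOperad.gen K g))).map n := by
  refine FreeOperad.hom_ext_obj fun t ht => ?_
  rw [FreeOperad.lift_toFree, SyntaxTree.toFree_eq_eval, ψ.map_eval]

/-- The projection of an operad onto its quotient by an ideal. -/
noncomputable def NSOperad.quotientMk {K : Type*} [Field K] (P : NSOperad K)
    (A : ∀ n, Set (P.obj n)) : P.Hom (P.quotient A) where
  map n := (P.ideal A n).mkQ
  map_one := rfl
  map_comp _ _ _ _ := rfl

/-- The composite of two morphisms of operads. -/
noncomputable def NSOperad.Hom.comp {K : Type*} [Field K] {O P Q : NSOperad K} (ψ : P.Hom Q)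
    (φ : O.Hom P) : O.Hom Q where
  map n := ψ.map n ∘ₗ φ.map n
  map_one := by simp [φ.map_one, ψ.map_one]
  map_comp i h x y := by simp [φ.map_comp, ψ.map_comp]

theorem NSOperad.ideal_le_ker {K : Type*} [Field K] {P Q : NSOperad K} (ψ : P.Hom Q)
    (A : ∀ n, Set (P.obj n)) (hA : ∀ n, ∀ x ∈ A n, ψ.map n x = 0) (n : ℕ) :
    P.ideal A n ≤ LinearMap.ker (ψ.map n) := by
  intro x hx
  rw [LinearMap.mem_ker]
  replace hx : P.IdealMem A n x := hx
  induction hx with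
  | gen x hx => exact hA _ x hx
  | zero n => exact map_zero _
  | add x y hx hy h1 h2 => rw [map_add, h1, h2, add_zero]
  | smul c x hx h1 => rw [map_smul, h1, smul_zero]
  | comp_left i h x y hx h1 => rw [ψ.map_comp, h1, map_zero, LinearMap.zero_apply]
  | comp_right i h x y hx h1 => rw [ψ.map_comp, h1, map_zero]

/-- The factorization through a quotient of a morphism that vanishes on the generators of the
ideal. -/
noncomputable def NSOperad.quotientLift {K : Type*} [Field K] {P Q : NSOperad K} (ψ : P.Hom Q)
    (A : ∀ n, Set (P.obj n)) (hA : ∀ n, ∀ x ∈ A n, ψ.map n x = 0) : (P.quotient A).Hom Q where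
  map n := (P.ideal A n).liftQ (ψ.map n) (NSOperad.ideal_le_ker ψ A hA n)
  map_one := ψ.map_one
  map_comp {n m k} i h x y := by
    obtain ⟨x, rfl⟩ := Submodule.mkQ_surjective _ x
    obtain ⟨y, rfl⟩ := Submodule.mkQ_surjective _ y
    exact ψ.map_comp i h x y

/-! ### Presentations and spaces of quadratic relations -/

/-- The class of a tree in a presented operad is its value there, so that congruence modulo the
ideal can be handled as equality of values in an operad. -/
theorem PresentedOperad.mkQ_toFree {K : Type*} [Field K] {G : Type}
    (R : Submodule K ((FreeOperad K G).obj 3)) (t : SyntaxTree G) (n : ℕ) (h : t.leaves = n) :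
    ((FreeOperad K G).ideal (quadraticRelations R) n).mkQ (t.toFree K n h) =
      t.eval (PresentedOperad R) (PresentedOperad.gen R) n h := by
  rw [SyntaxTree.toFree_eq_eval]
  exact ((FreeOperad K G).quotientMk (quadraticRelations R)).map_eval _ t n h

theorem FreeOperad.obj_zero {K : Type*} [Field K] {G : Type} (x : (FreeOperad K G).obj 0) :
    x = 0 := by
  refine Finsupp.ext fun t => ?_
  have h1 := t.1.leaves_pos
  have h2 : t.1.leaves = 0 := t.2
  omega

theorem SyntaxTree.eq_leaf {G : Type} {t : SyntaxTree G} (h : t.leaves = 1) : t = .leaf := by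
  cases t with
  | leaf => rfl
  | node g l r =>
    have := l.leaves_pos
    have := r.leaves_pos
    simp only [leaves] at h
    omega

theorem FreeOperad.obj_one {K : Type*} [Field K] {G : Type} (x : (FreeOperad K G).obj 1) :
    ∃ c : K, x = c • (FreeOperad K G).one := by
  have key : ∀ x : {t : SyntaxTree G // t.leaves = 1} →₀ K, ∃ c : K,
      x = c • Finsupp.single ⟨.leaf, rfl⟩ 1 := by
    intro x
    refine ⟨x ⟨.leaf, rfl⟩, Finsupp.ext fun t => ?_⟩
    obtain rfl : t = ⟨.leaf, rfl⟩ := Subtype.ext (SyntaxTree.eq_leaf t.2)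
    simp
  exact key x

/-- Every nontrivial composition raises the arity, so below arity `4` an ideal generated in
arity `3` reduces to its space of generators. -/
theorem FreeOperad.idealMem_low {K : Type*} [Field K] {G : Type}
    (R : Submodule K ((FreeOperad K G).obj 3)) {n : ℕ} {x : (FreeOperad K G).obj n}
    (hx : (FreeOperad K G).IdealMem (quadraticRelations R) n x) :
    (n < 3 → x = 0) ∧ ∀ h : n = 3, h ▸ x ∈ R := by
  induction hx with
  | gen x hx =>
    obtain ⟨rfl, r, hr, rfl⟩ := hx
    exact ⟨fun h => absurd h (lt_irrefl _), fun _ => hr⟩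
  | zero n => exact ⟨fun _ => rfl, by rintro rfl; exact R.zero_mem⟩
  | add x y hx hy h1 h2 =>
    refine ⟨fun h => by rw [h1.1 h, h2.1 h, add_zero], ?_⟩
    rintro rfl
    exact R.add_mem (h1.2 rfl) (h2.2 rfl)
  | smul c x hx h1 =>
    refine ⟨fun h => by rw [h1.1 h, smul_zero], ?_⟩
    rintro rfl
    exact R.smul_mem c (h1.2 rfl)
  | @comp_left n m k i h x y hx h1 =>
    rcases Nat.eq_zero_or_pos m with rfl | hm
    · rw [FreeOperad.obj_zero y, map_zero]
      exact ⟨fun _ => rfl, by rintro rfl; exact R.zero_mem⟩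
    refine ⟨fun hk => by rw [h1.1 (by omega), map_zero, LinearMap.zero_apply], ?_⟩
    rintro rfl
    by_cases hn : n < 3
    · rw [h1.1 hn, map_zero, LinearMap.zero_apply]
      exact R.zero_mem
    obtain rfl : n = 3 := by omega
    obtain rfl : m = 1 := by omega
    obtain ⟨c, rfl⟩ := FreeOperad.obj_one y
    rw [map_smul, NSOperad.comp_one]
    exact R.smul_mem c (h1.2 rfl)
  | @comp_right n m k i h x y hy h1 =>
    have hi := i.2
    refine ⟨fun hk => by rw [h1.1 (by omega), map_zero], ?_⟩
    rintro rfl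
    by_cases hm : m < 3
    · rw [h1.1 hm, map_zero]
      exact R.zero_mem
    obtain rfl : m = 3 := by omega
    obtain rfl : n = 1 := by omega
    obtain ⟨c, rfl⟩ := FreeOperad.obj_one x
    obtain rfl : i = 0 := Subsingleton.elim _ _
    rw [map_smul, LinearMap.smul_apply, NSOperad.one_comp]
    exact R.smul_mem c (h1.2 rfl)

/-- A morphism from a presented operad is a factorization of the morphism out of the free operad
with the same values on the generators. -/
theorem PresentedOperad.map_quotientMk {K : Type*} [Field K] {G : Type} {O : NSOperad K}
    {a : G → O.obj 2} {R : Submodule K ((FreeOperad K G).obj 3)}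
    (φ : (PresentedOperad R).Hom O) (h : ∀ g, φ.map 2 (PresentedOperad.gen R g) = a g) (n : ℕ)
    (x : (FreeOperad K G).obj n) :
    (FreeOperad.lift O a).map n x =
      φ.map n (((FreeOperad K G).quotientMk (quadraticRelations R)).map n x) := by
  obtain rfl : (fun g => φ.map 2 (PresentedOperad.gen R g)) = a := funext h
  exact LinearMap.congr_fun (FreeOperad.hom_eq_lift
    (φ.comp ((FreeOperad K G).quotientMk (quadraticRelations R))) n).symm x

/-- The space of relations of a binary quadratic presentation is determined by the operad and its
generators. -/
theorem IsPresentation.eq_relationSpace {K : Type*} [Field K] {G : Type} {O : NSOperad K}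
    {a : G → O.obj 2} {R : Submodule K ((FreeOperad K G).obj 3)} (h : IsPresentation O a R) :
    R = relationSpace O a := by
  obtain ⟨φ, hφ, hg⟩ := h
  have hker : relationSpace O a = (FreeOperad K G).ideal (quadraticRelations R) 3 := by
    ext x
    refine LinearMap.mem_ker.trans ?_
    rw [PresentedOperad.map_quotientMk φ hg 3]
    exact (map_eq_zero_iff _ (hφ 3).1).trans (Submodule.Quotient.mk_eq_zero _)
  rw [hker]
  exact le_antisymm (fun x hx => .gen x ⟨rfl, x, hx, rfl⟩)
    fun x hx => (FreeOperad.idealMem_low R hx).2 rfl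

/-- An operad generated by the `a g` is presented by its quadratic relations as soon as these
relations generate all the relations. -/
theorem isPresentation_relationSpace {K : Type*} [Field K] {G : Type} {O : NSOperad K}
    {a : G → O.obj 2} (hsurj : ∀ n, Function.Surjective ((FreeOperad.lift O a).map n))
    (hker : ∀ n, LinearMap.ker ((FreeOperad.lift O a).map n) ≤
      (FreeOperad K G).ideal (quadraticRelations (relationSpace O a)) n) :
    IsPresentation O a (relationSpace O a) := by
  refine ⟨NSOperad.quotientLift (FreeOperad.lift O a) _ ?_, fun n => ⟨?_, ?_⟩, fun g => ?_⟩
  · rintro n x ⟨rfl, r, hr, rfl⟩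
    exact hr
  · exact LinearMap.ker_eq_bot.1 (Submodule.ker_liftQ_eq_bot _ _ _ (hker n))
  · intro y
    obtain ⟨x, rfl⟩ := hsurj n y
    exact ⟨Submodule.Quotient.mk x, rfl⟩
  · exact FreeOperad.lift_gen O a g

/-! ### Equality of syntax trees in an operad -/

/-- Two syntax trees with the same arity and the same value in `O`, when the nodes are interpreted
by `a`. -/
def SyntaxTree.EvalEq {K : Type*} [Field K] {G : Type} (O : NSOperad K) (a : G → O.obj 2)
    (t t' : SyntaxTree G) : Prop :=
  t.leaves = t'.leaves ∧ ∀ n h h', t.eval O a n h = t'.eval O a n h'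

namespace SyntaxTree.EvalEq

variable {K : Type*} [Field K] {G : Type} {O : NSOperad K} {a : G → O.obj 2}
  {t t' t'' l l' r r' : SyntaxTree G}

theorem refl (t : SyntaxTree G) : EvalEq O a t t := ⟨rfl, fun _ _ _ => rfl⟩

theorem symm (h : EvalEq O a t t') : EvalEq O a t' t :=
  ⟨h.1.symm, fun n h1 h2 => (h.2 n h2 h1).symm⟩

theorem trans (h : EvalEq O a t t') (h' : EvalEq O a t' t'') : EvalEq O a t t'' :=
  ⟨h.1.trans h'.1, fun n h1 h2 => (h.2 n h1 (h.1 ▸ h1)).trans (h'.2 n _ h2)⟩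

theorem node (g : G) (hl : EvalEq O a l l') (hr : EvalEq O a r r') :
    EvalEq O a (.node g l r) (.node g l' r') := by
  have e1 := hl.1
  have e2 := hr.1
  refine ⟨by simp only [leaves, e1, e2], fun n h h' => ?_⟩
  have hn := h
  simp only [leaves] at hn
  rw [eval_node O a g l r n l.leaves r.leaves (1 + r.leaves) h rfl rfl ⟨0, by omega⟩ rfl
      (by omega) (by omega),
    eval_node O a g l' r' n l.leaves r.leaves (1 + r.leaves) h' e1.symm e2.symm ⟨0, by omega⟩ rfl
      (by omega) (by omega), hl.2 _ rfl e1.symm, hr.2 _ rfl e2.symm]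

theorem graft {s s' : SyntaxTree G} (h : EvalEq O a s s') (i : ℕ) (hi : i < s.leaves)
    (t : SyntaxTree G) : EvalEq O a (s.graft i t) (s'.graft i t) := by
  have e := h.1
  have h1 := leaves_graft s t i hi
  have h2 := leaves_graft s' t i (e ▸ hi)
  refine ⟨by omega, fun n hn hn' => ?_⟩
  rw [eval_graft O a s t s.leaves t.leaves n ⟨i, hi⟩ (by omega) rfl rfl hn,
    eval_graft O a s' t s.leaves t.leaves n ⟨i, hi⟩ (by omega) e.symm rfl hn', h.2 _ rfl e.symm]

/-- The instances of an equality between two trees of arity `3`: the three leaves may be replaced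
by arbitrary trees. -/
theorem subst {s s' : SyntaxTree G} (h : EvalEq O a s s') (hs : s.leaves = 3)
    (A B C : SyntaxTree G) :
    EvalEq O a (((s.graft 2 C).graft 1 B).graft 0 A) (((s'.graft 2 C).graft 1 B).graft 0 A) := by
  have h1 := leaves_graft s C 2 (by omega)
  have hC := C.leaves_pos
  have h2 := leaves_graft (s.graft 2 C) B 1 (by omega)
  have hB := B.leaves_pos
  exact ((h.graft 2 (by omega) C).graft 1 (by omega) B).graft 0 (by omega) A

end SyntaxTree.EvalEq

/-! ### Words of syntax trees -/

/-- The word that a syntax tree on the generators `⊣ₐ = 0 a` and `⊢ₐ = a 0` takes as its value in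
the operad of words: the letter `0` of a generator leaves the subtree word unchanged, and the letter
`a` replaces every letter `c` by `max a c`. -/
def SyntaxTree.code {γ : ℕ} : SyntaxTree (PolyGen γ) → List (Fin (γ + 1))
  | .leaf => [0]
  | .node (.left a) l r => l.code ++ r.code.map (max a.succ)
  | .node (.right a) l r => l.code.map (max a.succ) ++ r.code

theorem ofFn_wordComp {γ n m k : ℕ} (i : Fin n) (h : k + 1 = n + m) (u : Fin n → Fin (γ + 1))
    (v : Fin m → Fin (γ + 1)) :
    List.ofFn (wordComp i h u v) =
      (List.ofFn u).take i ++ ((List.ofFn v).map (max (u i)) ++ (List.ofFn u).drop (i + 1)) := by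
  have hi := i.2
  refine List.ext_getElem (by simp; omega) fun j hj hj' => ?_
  simp only [List.length_ofFn] at hj
  simp only [List.getElem_ofFn, wordComp, List.getElem_append, List.length_take, List.length_ofFn,
    List.getElem_take, List.length_map, List.getElem_map, List.getElem_drop]
  grind

theorem ofFn_wordComp_wordComp {γ n p q k : ℕ} (x : Fin 2 → Fin (γ + 1)) (u : Fin p → Fin (γ + 1))
    (v : Fin q → Fin (γ + 1)) (z : Fin k) (hz : (z : ℕ) = 0) (hk : k + 1 = 2 + q)
    (h : n + 1 = k + p) :
    List.ofFn (wordComp z h (wordComp 1 hk x v) u) =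
      (List.ofFn u).map (max (x 0)) ++ (List.ofFn v).map (max (x 1)) := by
  have e : wordComp 1 hk x v z = x 0 := by simp [wordComp, hz]
  rw [ofFn_wordComp, ofFn_wordComp, e]
  simp [hz]

theorem Dias.eval_eq_single (K : Type*) [Field K] {γ : ℕ} (t : SyntaxTree (PolyGen γ)) (n : ℕ)
    (h : t.leaves = n) :
    ∃ w : ((wordOperad γ).suboperad (diasGenerators γ)).obj n,
      t.eval (Dias K γ) (Dias.gen K) n h = Finsupp.single w (1 : K) ∧ List.ofFn w.1 = t.code := by
  induction t generalizing n with
  | leaf =>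
    simp only [SyntaxTree.leaves] at h
    subst h
    exact ⟨((wordOperad γ).suboperad (diasGenerators γ)).one, rfl, rfl⟩
  | node g l r hl hr =>
    have hn := h
    simp only [SyntaxTree.leaves] at hn
    obtain ⟨u, hu, hu'⟩ := hl _ rfl
    obtain ⟨v, hv, hv'⟩ := hr _ rfl
    rw [SyntaxTree.eval_node _ _ g l r n l.leaves r.leaves (1 + r.leaves) h rfl rfl ⟨0, by omega⟩
      rfl (by omega) (by omega), hu, hv]
    refine ⟨((wordOperad γ).suboperad (diasGenerators γ)).comp (n := 1 + r.leaves) ⟨0, by omega⟩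
      (by omega) (((wordOperad γ).suboperad (diasGenerators γ)).comp (n := 2) 1 (by omega)
        ⟨g.word, .gen _ ⟨rfl, g, rfl⟩⟩ v) u, ?_, ?_⟩
    · refine Eq.trans (congrArg (fun z => (Dias K γ).comp _ _ z (Finsupp.single u (1 : K)))
        (bilinearExtension_single K _ _ _ _ _)) ?_
      refine (bilinearExtension_single K _ _ _ _ _).trans ?_
      rw [mul_one, mul_one]
    · refine (ofFn_wordComp_wordComp g.word u.1 v.1 (⟨0, by omega⟩ : Fin (1 + r.leaves)) rfl
        (by omega) (by omega)).trans ?_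
      have hz : max (0 : Fin (γ + 1)) = id := funext fun c => max_eq_right (Fin.zero_le c)
      rw [hu', hv']
      cases g <;> simp [PolyGen.word, SyntaxTree.code, hz]

theorem Dias.eval_eq_of_code_eq (K : Type*) [Field K] {γ : ℕ} {t t' : SyntaxTree (PolyGen γ)}
    (e : t.code = t'.code) (n : ℕ) (h : t.leaves = n) (h' : t'.leaves = n) :
    t.eval (Dias K γ) (Dias.gen K) n h = t'.eval (Dias K γ) (Dias.gen K) n h' := by
  obtain ⟨w, hw, hc⟩ := Dias.eval_eq_single K t n h
  obtain ⟨w', hw', hc'⟩ := Dias.eval_eq_single K t' n h'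
  rw [hw, hw', Subtype.ext (List.ofFn_injective (hc.trans (e.trans hc'.symm)))]

/-! ### Normal forms modulo the quadratic relations -/

/-- Equality of two syntax trees modulo the ideal generated by the quadratic relations of
`Dias`. -/
abbrev Dias.Congr (K : Type*) [Field K] {γ : ℕ} : SyntaxTree (PolyGen γ) →
    SyntaxTree (PolyGen γ) → Prop :=
  SyntaxTree.EvalEq (PresentedOperad (relationSpace (Dias K γ) (Dias.gen K)))
    (PresentedOperad.gen _)

theorem Dias.congr_of_code_eq (K : Type*) [Field K] {γ : ℕ} {s s' : SyntaxTree (PolyGen γ)}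
    (hs : s.leaves = 3) (hs' : s'.leaves = 3) (h : s.code = s'.code) : Dias.Congr K s s' := by
  refine ⟨hs.trans hs'.symm, ?_⟩
  rintro n h1 h2
  obtain rfl : 3 = n := hs.symm.trans h1
  rw [← PresentedOperad.mkQ_toFree, ← PresentedOperad.mkQ_toFree]
  refine (Submodule.Quotient.eq _).2 (.gen _ ⟨rfl, _, ?_, rfl⟩)
  refine LinearMap.mem_ker.2 ?_
  rw [map_sub, FreeOperad.lift_toFree, FreeOperad.lift_toFree, Dias.eval_eq_of_code_eq K h,
    sub_self]
  exact hs'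

/-- The comb `(… ((t ⊣ y₁) ⊣ y₂) …)`, which appends the letters `y₁, y₂, …` to the word of `t`. -/
def SyntaxTree.appendLeft {γ : ℕ} (t : SyntaxTree (PolyGen γ)) (ys : List (Fin γ)) :
    SyntaxTree (PolyGen γ) :=
  ys.foldl (fun t y => .node (.left y) t .leaf) t

/-- The comb `(… x₁ ⊢ (x₂ ⊢ t) …)`, which prepends the letters `x₁, x₂, …` to the word of `t`. -/
def SyntaxTree.prependRight {γ : ℕ} (xs : List (Fin γ)) (t : SyntaxTree (PolyGen γ)) :
    SyntaxTree (PolyGen γ) :=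
  xs.foldr (fun x t => .node (.right x) .leaf t) t

theorem Fin.succ_max_succ {n : ℕ} (a b : Fin n) : (max a b).succ = max a.succ b.succ :=
  Fin.strictMono_succ.monotone.map_max

namespace Dias.Congr

open SyntaxTree PolyGen

variable {K : Type*} [Field K] {γ : ℕ} {t t' : SyntaxTree (PolyGen γ)}

theorem left_left (a b : Fin γ) (A B C : SyntaxTree (PolyGen γ)) :
    Dias.Congr K (.node (left a) A (.node (left b) B C))
      (.node (left (max a b)) (.node (left a) A B) C) := by
  simpa [SyntaxTree.graft, leaves] using
    (Dias.congr_of_code_eq K (s := .node (left a) .leaf (.node (left b) .leaf .leaf))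
      (s' := .node (left (max a b)) (.node (left a) .leaf .leaf) .leaf) rfl rfl
      (by simp [code, Fin.succ_max_succ])).subst rfl A B C

theorem left_right (a b : Fin γ) (A B C : SyntaxTree (PolyGen γ)) :
    Dias.Congr K (.node (left a) A (.node (right b) B C))
      (.node (left a) (.node (left (max a b)) A B) C) := by
  simpa [SyntaxTree.graft, leaves] using
    (Dias.congr_of_code_eq K (s := .node (left a) .leaf (.node (right b) .leaf .leaf))
      (s' := .node (left a) (.node (left (max a b)) .leaf .leaf) .leaf) rfl rfl
      (by simp [code, Fin.succ_max_succ])).subst rfl A B C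

theorem right_right (a b : Fin γ) (A B C : SyntaxTree (PolyGen γ)) :
    Dias.Congr K (.node (right a) (.node (right b) A B) C)
      (.node (right (max a b)) A (.node (right a) B C)) := by
  simpa [SyntaxTree.graft, leaves] using
    (Dias.congr_of_code_eq K (s := .node (right a) (.node (right b) .leaf .leaf) .leaf)
      (s' := .node (right (max a b)) .leaf (.node (right a) .leaf .leaf)) rfl rfl
      (by simp [code, Fin.succ_max_succ])).subst rfl A B C

theorem right_left (a b : Fin γ) (A B C : SyntaxTree (PolyGen γ)) :
    Dias.Congr K (.node (right a) (.node (left b) A B) C)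
      (.node (right a) A (.node (right (max a b)) B C)) := by
  simpa [SyntaxTree.graft, leaves] using
    (Dias.congr_of_code_eq K (s := .node (right a) (.node (left b) .leaf .leaf) .leaf)
      (s' := .node (right a) .leaf (.node (right (max a b)) .leaf .leaf)) rfl rfl
      (by simp [code, Fin.succ_max_succ])).subst rfl A B C

theorem right_left_comm (a b : Fin γ) (A B C : SyntaxTree (PolyGen γ)) :
    Dias.Congr K (.node (right a) A (.node (left b) B C))
      (.node (left b) (.node (right a) A B) C) := by
  simpa [SyntaxTree.graft, leaves] using
    (Dias.congr_of_code_eq K (s := .node (right a) .leaf (.node (left b) .leaf .leaf))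
      (s' := .node (left b) (.node (right a) .leaf .leaf) .leaf) rfl rfl
      (by simp [code])).subst rfl A B C

theorem appendLeft (h : Dias.Congr K t t') (ys : List (Fin γ)) :
    Dias.Congr K (t.appendLeft ys) (t'.appendLeft ys) := by
  induction ys generalizing t t' with
  | nil => exact h
  | cons y ys ih => exact ih (.node _ h (.refl _))

theorem prependRight (h : Dias.Congr K t t') (xs : List (Fin γ)) :
    Dias.Congr K (SyntaxTree.prependRight xs t) (SyntaxTree.prependRight xs t') := by
  induction xs with
  | nil => exact h
  | cons x xs ih => exact .node _ (.refl _) ih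

theorem node_right_appendLeft (x : Fin γ) (A B : SyntaxTree (PolyGen γ)) (ys : List (Fin γ)) :
    Dias.Congr K (.node (right x) A (B.appendLeft ys))
      ((SyntaxTree.node (right x) A B).appendLeft ys) := by
  induction ys generalizing B with
  | nil => exact .refl _
  | cons y ys ih => exact (ih _).trans ((right_left_comm x y A B .leaf).appendLeft ys)

theorem prependRight_appendLeft (xs ys : List (Fin γ)) (t : SyntaxTree (PolyGen γ)) :
    Dias.Congr K (SyntaxTree.prependRight xs (t.appendLeft ys))
      ((SyntaxTree.prependRight xs t).appendLeft ys) := by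
  induction xs with
  | nil => exact .refl _
  | cons x xs ih =>
    exact (SyntaxTree.EvalEq.node _ (.refl _) ih).trans (node_right_appendLeft x _ _ ys)

theorem max_succ_map (a b : Fin γ) (c : List (Fin (γ + 1))) :
    (c.map (max b.succ)).map (max a.succ) = c.map (max (max a b).succ) := by
  simp [Fin.succ_max_succ, max_assoc]

/-- Under a node `⊣ₐ`, the right subtree can be replaced by the comb of its letters. -/
theorem exists_node_left (r : SyntaxTree (PolyGen γ)) (a : Fin γ) :
    ∃ us : List (Fin γ), us.map Fin.succ = r.code.map (max a.succ) ∧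
      ∀ l, Dias.Congr K (.node (left a) l r) (l.appendLeft us) := by
  induction r generalizing a with
  | leaf => exact ⟨[a], by simp [code], fun l => .refl _⟩
  | node g r₁ r₂ h₁ h₂ =>
    cases g with
    | left b =>
      obtain ⟨us, hus, hu⟩ := h₁ a
      obtain ⟨vs, hvs, hv⟩ := h₂ (max a b)
      refine ⟨us ++ vs, ?_, fun l => ?_⟩
      · rw [code, List.map_append, List.map_append, hus, hvs, max_succ_map]
      · rw [SyntaxTree.appendLeft, List.foldl_append]
        exact (left_left a b l r₁ r₂).trans ((hv _).trans ((hu l).appendLeft vs))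
    | right b =>
      obtain ⟨us, hus, hu⟩ := h₁ (max a b)
      obtain ⟨vs, hvs, hv⟩ := h₂ a
      refine ⟨us ++ vs, ?_, fun l => ?_⟩
      · rw [code, List.map_append, List.map_append, hus, hvs, max_succ_map]
      · rw [SyntaxTree.appendLeft, List.foldl_append]
        exact (left_right a b l r₁ r₂).trans ((hv _).trans ((hu l).appendLeft vs))

/-- Under a node `⊢ₐ`, the left subtree can be replaced by the comb of its letters. -/
theorem exists_node_right (l : SyntaxTree (PolyGen γ)) (a : Fin γ) :
    ∃ us : List (Fin γ), us.map Fin.succ = l.code.map (max a.succ) ∧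
      ∀ r, Dias.Congr K (.node (right a) l r) (SyntaxTree.prependRight us r) := by
  induction l generalizing a with
  | leaf => exact ⟨[a], by simp [code], fun l => .refl _⟩
  | node g l₁ l₂ h₁ h₂ =>
    cases g with
    | left b =>
      obtain ⟨us, hus, hu⟩ := h₁ a
      obtain ⟨vs, hvs, hv⟩ := h₂ (max a b)
      refine ⟨us ++ vs, ?_, fun r => ?_⟩
      · rw [code, List.map_append, List.map_append, hus, hvs, max_succ_map]
      · rw [SyntaxTree.prependRight, List.foldr_append]
        exact (right_left a b l₁ l₂ r).trans ((hu _).trans ((hv r).prependRight us))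
    | right b =>
      obtain ⟨us, hus, hu⟩ := h₁ (max a b)
      obtain ⟨vs, hvs, hv⟩ := h₂ a
      refine ⟨us ++ vs, ?_, fun r => ?_⟩
      · rw [code, List.map_append, List.map_append, hus, hvs, max_succ_map]
      · rw [SyntaxTree.prependRight, List.foldr_append]
        exact (right_right a b l₁ l₂ r).trans ((hu _).trans ((hv r).prependRight us))

/-- A tree whose word is `x₁ … xₚ 0 y₁ … y_q` is congruent to the double comb on these letters. -/
theorem exists_normalForm (t : SyntaxTree (PolyGen γ)) :
    ∃ xs ys : List (Fin γ), t.code = xs.map Fin.succ ++ 0 :: ys.map Fin.succ ∧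
      Dias.Congr K t ((SyntaxTree.prependRight xs .leaf).appendLeft ys) := by
  induction t with
  | leaf => exact ⟨[], [], rfl, .refl _⟩
  | node g l r hl hr =>
    cases g with
    | left a =>
      obtain ⟨xs, ys, hc, h⟩ := hl
      obtain ⟨us, hus, hu⟩ := exists_node_left (K := K) r a
      refine ⟨xs, ys ++ us, by simp [code, hc, hus], ?_⟩
      rw [SyntaxTree.appendLeft, List.foldl_append]
      exact (hu l).trans (h.appendLeft us)
    | right a =>
      obtain ⟨xs, ys, hc, h⟩ := hr
      obtain ⟨us, hus, hu⟩ := exists_node_right (K := K) l a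
      refine ⟨us ++ xs, ys, by simp [code, hc, hus], ?_⟩
      rw [SyntaxTree.prependRight, List.foldr_append]
      exact (hu r).trans ((h.prependRight us).trans (prependRight_appendLeft us ys _))

theorem append_zero_inj {xs ys xs' ys' : List (Fin γ)}
    (h : xs.map Fin.succ ++ 0 :: ys.map Fin.succ = xs'.map Fin.succ ++ 0 :: ys'.map Fin.succ) :
    xs = xs' ∧ ys = ys' := by
  induction xs generalizing xs' with
  | nil =>
    cases xs' with
    | nil =>
      simp only [List.map_nil, List.nil_append, List.cons.injEq, true_and] at h
      exact ⟨rfl, List.map_injective_iff.2 (Fin.succ_injective _) h⟩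
    | cons x' xs' => exact absurd (List.cons.inj h).1.symm (Fin.succ_ne_zero _)
  | cons x xs ih =>
    cases xs' with
    | nil => exact absurd (List.cons.inj h).1 (Fin.succ_ne_zero _)
    | cons x' xs' =>
      simp only [List.map_cons, List.cons_append, List.cons.injEq, Fin.succ_inj] at h
      obtain ⟨h1, h2⟩ := ih h.2
      exact ⟨by rw [h.1, h1], h2⟩

/-- The word of a tree determines its class modulo the quadratic relations. -/
theorem of_code_eq (h : t.code = t'.code) : Dias.Congr K t t' := by
  obtain ⟨xs, ys, hc, hn⟩ := exists_normalForm (K := K) t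
  obtain ⟨xs', ys', hc', hn'⟩ := exists_normalForm (K := K) t'
  obtain ⟨rfl, rfl⟩ := append_zero_inj (hc.symm.trans (h.trans hc'))
  exact hn.trans hn'.symm

end Dias.Congr

/-! ### The presentation of the pluriassociative operad -/

theorem Dias.lift_surjective (K : Type*) [Field K] (γ n : ℕ) :
    Function.Surjective ((FreeOperad.lift (Dias K γ) (Dias.gen K)).map n) := by
  have key : ∀ (n : ℕ) (w : (wordOperad γ).obj n)
      (hw : (wordOperad γ).Generated (diasGenerators γ) n w),
      ∃ v, (FreeOperad.lift (Dias K γ) (Dias.gen K)).map n v =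
        Finsupp.single (⟨w, hw⟩ : ((wordOperad γ).suboperad (diasGenerators γ)).obj n) (1 : K) := by
    intro n w hw
    induction hw with
    | one => exact ⟨_, (FreeOperad.lift (Dias K γ) (Dias.gen K)).map_one⟩
    | gen x hx =>
      obtain ⟨rfl, g, rfl⟩ := hx
      exact ⟨_, FreeOperad.lift_gen _ _ g⟩
    | comp i h x y hx hy ihx ihy =>
      obtain ⟨v, hv⟩ := ihx
      obtain ⟨v', hv'⟩ := ihy
      refine ⟨(FreeOperad K (PolyGen γ)).comp i h v v', ?_⟩
      rw [(FreeOperad.lift (Dias K γ) (Dias.gen K)).map_comp, hv, hv']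
      refine (bilinearExtension_single K _ _ _ _ _).trans ?_
      rw [mul_one]
      rfl
  refine LinearMap.range_eq_top.1 (top_unique ?_)
  rintro x -
  replace key : ∀ w, Finsupp.single w (1 : K) ∈
      LinearMap.range ((FreeOperad.lift (Dias K γ) (Dias.gen K)).map n) := fun w => key n w.1 w.2
  induction x using Finsupp.induction_linear with
  | zero => exact Submodule.zero_mem _
  | add f g hf hg => exact Submodule.add_mem _ hf hg
  | single w c =>
    have e : Finsupp.single w c = c • Finsupp.single w (1 : K) := by simp
    exact e ▸ Submodule.smul_mem _ c (key w)

/-- The quotient map by the ideal of the quadratic relations factors, on trees, through their words;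
hence it kills the kernel of the morphism to `Dias`. -/
theorem Dias.ker_lift_le (K : Type*) [Field K] (γ n : ℕ) :
    LinearMap.ker ((FreeOperad.lift (Dias K γ) (Dias.gen K)).map n) ≤
      (FreeOperad K (PolyGen γ)).ideal
        (quadraticRelations (relationSpace (Dias K γ) (Dias.gen K))) n := by
  let I := (FreeOperad K (PolyGen γ)).ideal
        (quadraticRelations (relationSpace (Dias K γ) (Dias.gen K))) n
  choose w hw hc using fun t : {t : SyntaxTree (PolyGen γ) // t.leaves = n} =>
    Dias.eval_eq_single K t.1 n t.2
  have hs : ∃ s : (Dias K γ).obj n →ₗ[K] ((FreeOperad K (PolyGen γ)).obj n ⧸ I),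
      s ∘ₗ (FreeOperad.lift (Dias K γ) (Dias.gen K)).map n = I.mkQ := by
    let q : {t : SyntaxTree (PolyGen γ) // t.leaves = n} →
      (FreeOperad K (PolyGen γ)).obj n ⧸ I := fun t => I.mkQ (t.1.toFree K n t.2)
    -- All words of arity `n` come from trees, so the default value `0` is immaterial.
    refine ⟨Finsupp.linearCombination K (Function.extend w q 0),
      FreeOperad.hom_ext_obj fun t ht => ?_⟩
    refine (congrArg (Finsupp.linearCombination K (Function.extend w q 0))
      ((FreeOperad.lift_toFree _ _ t n ht).trans (hw ⟨t, ht⟩))).trans ?_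
    refine (Finsupp.linearCombination_single K _ _).trans ?_
    rw [one_smul]
    have hfac : q.FactorsThrough w := by
      intro t t' h
      refine (PresentedOperad.mkQ_toFree _ _ _ _).trans
        (Eq.trans ?_ (PresentedOperad.mkQ_toFree _ _ _ _).symm)
      exact (Dias.Congr.of_code_eq (by rw [← hc, ← hc, h])).2 _ _ _
    exact hfac.extend_apply _ _
  obtain ⟨s, hs⟩ := hs
  intro x hx
  rw [← Submodule.Quotient.mk_eq_zero, ← Submodule.mkQ_apply, ← hs, LinearMap.comp_apply,
    LinearMap.mem_ker.1 hx, map_zero]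

theorem Dias.isPresentation (K : Type*) [Field K] (γ : ℕ) :
    IsPresentation (Dias K γ) (Dias.gen K) (relationSpace (Dias K γ) (Dias.gen K)) :=
  isPresentation_relationSpace (Dias.lift_surjective K γ) (Dias.ker_lift_le K γ)

/-! ### The coefficient functionals of the quadratic relations -/

open SyntaxTree FreeOperad PolyGen in
/-- The pairing with `ρ` extracts the coefficient of the word `c` in the value in `Dias` of an
element of arity `3`; that is, `ρ` is the signed sum of the trees whose word is `c`. -/
def IsWordFunctional (K : Type*) [Field K] {γ : ℕ} (ρ : (FreeOperad K (PolyGen γ)).obj 3)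
    (c : List (Fin (γ + 1))) : Prop :=
  (∀ x y, scalarProduct K _ ρ (gen₁ K x y) =
    if (node x (node y leaf leaf) leaf).code = c then 1 else 0) ∧
  ∀ x y, scalarProduct K _ ρ (gen₂ K x y) =
    if (node x leaf (node y leaf leaf)).code = c then 1 else 0

theorem SyntaxTree.eq_of_leaves_eq_two {G : Type} {t : SyntaxTree G} (h : t.leaves = 2) :
    ∃ g, t = .node g .leaf .leaf := by
  cases t with
  | leaf => simp [leaves] at h
  | node g l r =>
    have := l.leaves_pos
    have := r.leaves_pos
    simp only [leaves] at h
    exact ⟨g, by rw [eq_leaf (t := l) (by omega), eq_leaf (t := r) (by omega)]⟩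

theorem SyntaxTree.eq_of_leaves_eq_three {G : Type} {t : SyntaxTree G} (h : t.leaves = 3) :
    ∃ x y, t = .node x (.node y .leaf .leaf) .leaf ∨ t = .node x .leaf (.node y .leaf .leaf) := by
  cases t with
  | leaf => simp [leaves] at h
  | node x l r =>
    have := l.leaves_pos
    have := r.leaves_pos
    simp only [leaves] at h
    rcases (by omega : l.leaves = 1 ∨ r.leaves = 1) with e | e
    · obtain ⟨y, hy⟩ := eq_of_leaves_eq_two (t := r) (by omega)
      exact ⟨x, y, .inr (by rw [eq_leaf e, hy])⟩
    · obtain ⟨y, hy⟩ := eq_of_leaves_eq_two (t := l) (by omega)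
      exact ⟨x, y, .inl (by rw [eq_leaf e, hy])⟩

/-- The coefficient of the word `c`, as a linear form on the arity `3` component of `Dias`. -/
noncomputable def Dias.coeff (K : Type*) [Field K] {γ : ℕ} (c : List (Fin (γ + 1))) :
    (Dias K γ).obj 3 →ₗ[K] K :=
  Finsupp.linearCombination K
    (fun w : ((wordOperad γ).suboperad (diasGenerators γ)).obj 3 =>
      if List.ofFn w.1 = c then (1 : K) else 0)

theorem Dias.coeff_eval (K : Type*) [Field K] {γ : ℕ} (c : List (Fin (γ + 1)))
    (t : SyntaxTree (PolyGen γ)) (h : t.leaves = 3) :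
    Dias.coeff K c (t.eval (Dias K γ) (Dias.gen K) 3 h) = if t.code = c then 1 else 0 := by
  obtain ⟨w, hw, hc⟩ := Dias.eval_eq_single K t 3 h
  rw [hw]
  refine (Finsupp.linearCombination_single K _ _).trans ?_
  rw [one_smul, hc]

theorem IsWordFunctional.scalarProduct_eq {K : Type*} [Field K] {γ : ℕ}
    {ρ : (FreeOperad K (PolyGen γ)).obj 3} {c : List (Fin (γ + 1))}
    (h : IsWordFunctional K ρ c) (r : (FreeOperad K (PolyGen γ)).obj 3) :
    scalarProduct K _ ρ r =
      Dias.coeff K c ((FreeOperad.lift (Dias K γ) (Dias.gen K)).map 3 r) := by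
  suffices e : scalarProduct K _ ρ =
      Dias.coeff K c ∘ₗ (FreeOperad.lift (Dias K γ) (Dias.gen K)).map 3 from
    LinearMap.congr_fun e r
  refine FreeOperad.hom_ext_obj fun t ht => ?_
  rw [LinearMap.comp_apply, FreeOperad.lift_toFree, Dias.coeff_eval]
  obtain ⟨x, y, rfl | rfl⟩ := SyntaxTree.eq_of_leaves_eq_three ht
  · exact (congrArg _ (FreeOperad.gen₁_eq K x y).symm).trans (h.1 x y)
  · exact (congrArg _ (FreeOperad.gen₂_eq K x y).symm).trans (h.2 x y)

namespace IsWordFunctional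

open SyntaxTree FreeOperad PolyGen

variable (K : Type*) [Field K] {γ : ℕ}

theorem left_right (a a' : Fin γ) :
    IsWordFunctional K (gen₁ K (left a) (right a') - gen₂ K (right a') (left a))
      [a'.succ, 0, a.succ] := by
  constructor <;> rintro (x | x) (y | y) <;>
    simp only [map_sub, LinearMap.sub_apply, scalarProduct_gen₁_gen₁, scalarProduct_gen₂_gen₂,
      scalarProduct_gen₁_gen₂, scalarProduct_gen₂_gen₁] <;>
    simp [code, ← Fin.succ_max_succ] <;> grind

theorem left_left_of_lt {a b : Fin γ} (h : a < b) :
    IsWordFunctional K (gen₁ K (left a) (left b) - gen₂ K (left a) (right b))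
      [0, b.succ, a.succ] := by
  constructor <;> rintro (x | x) (y | y) <;>
    simp only [map_sub, LinearMap.sub_apply, scalarProduct_gen₁_gen₁, scalarProduct_gen₂_gen₂,
      scalarProduct_gen₁_gen₂, scalarProduct_gen₂_gen₁] <;>
    simp [code, ← Fin.succ_max_succ] <;> grind

theorem right_left_of_lt {a b : Fin γ} (h : a < b) :
    IsWordFunctional K (gen₁ K (right a) (left b) - gen₂ K (right a) (right b))
      [a.succ, b.succ, 0] := by
  constructor <;> rintro (x | x) (y | y) <;>
    simp only [map_sub, LinearMap.sub_apply, scalarProduct_gen₁_gen₁, scalarProduct_gen₂_gen₂,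
      scalarProduct_gen₁_gen₂, scalarProduct_gen₂_gen₁] <;>
    simp [code, ← Fin.succ_max_succ] <;> grind

theorem left_left_of_gt {a b : Fin γ} (h : a < b) :
    IsWordFunctional K (gen₁ K (left b) (left a) - gen₂ K (left a) (left b))
      [0, a.succ, b.succ] := by
  constructor <;> rintro (x | x) (y | y) <;>
    simp only [map_sub, LinearMap.sub_apply, scalarProduct_gen₁_gen₁, scalarProduct_gen₂_gen₂,
      scalarProduct_gen₁_gen₂, scalarProduct_gen₂_gen₁] <;>
    simp [code, ← Fin.succ_max_succ] <;> grind

theorem right_right_of_gt {a b : Fin γ} (h : a < b) :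
    IsWordFunctional K (gen₁ K (right a) (right b) - gen₂ K (right b) (right a))
      [b.succ, a.succ, 0] := by
  constructor <;> rintro (x | x) (y | y) <;>
    simp only [map_sub, LinearMap.sub_apply, scalarProduct_gen₁_gen₁, scalarProduct_gen₂_gen₂,
      scalarProduct_gen₁_gen₂, scalarProduct_gen₂_gen₁] <;>
    simp [code, ← Fin.succ_max_succ] <;> grind

theorem left_left_self (d : Fin γ) :
    IsWordFunctional K (gen₁ K (left d) (left d) -
        ∑ c ∈ Finset.Iic d, (gen₂ K (left d) (left c) + gen₂ K (left d) (right c)))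
      [0, d.succ, d.succ] := by
  constructor <;> rintro (x | x) (y | y) <;>
    simp only [map_sub, map_sum, map_add, LinearMap.sub_apply, LinearMap.add_apply,
      LinearMap.sum_apply, scalarProduct_gen₁_gen₁, scalarProduct_gen₂_gen₂,
      scalarProduct_gen₁_gen₂, scalarProduct_gen₂_gen₁] <;>
    by_cases hd : d = x <;> simp [code, ← Fin.succ_max_succ, hd] <;> grind

theorem right_right_self (d : Fin γ) :
    IsWordFunctional K
      (∑ c ∈ Finset.Iic d, (gen₁ K (right d) (right c) + gen₁ K (right d) (left c)) -
        gen₂ K (right d) (right d))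
      [d.succ, d.succ, 0] := by
  constructor <;> rintro (x | x) (y | y) <;>
    simp only [map_sub, map_sum, map_add, LinearMap.sub_apply, LinearMap.add_apply,
      LinearMap.sum_apply, scalarProduct_gen₁_gen₁, scalarProduct_gen₂_gen₂,
      scalarProduct_gen₁_gen₂, scalarProduct_gen₂_gen₁] <;>
    by_cases hd : d = x <;> simp [code, ← Fin.succ_max_succ, hd] <;> grind

end IsWordFunctional

/-! ### The scalar product and the annihilator of the relations -/

theorem diagonalForm_apply (K : Type*) [Field K] {T : Type*} (σ : T → ℤ) (x y : T →₀ K) :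
    diagonalForm K σ x y = x.sum fun t c => c * (σ t * y t) := by
  simp [diagonalForm, Finsupp.linearCombination_apply, Finsupp.sum, LinearMap.sum_apply]

theorem diagonalForm_comm (K : Type*) [Field K] {T : Type*} (σ : T → ℤ) (x y : T →₀ K) :
    diagonalForm K σ x y = diagonalForm K σ y x := by
  classical
  rw [diagonalForm_apply, diagonalForm_apply,
    Finsupp.sum_of_support_subset x (Finset.subset_union_left (s₂ := y.support)) _ (by simp),
    Finsupp.sum_of_support_subset y (Finset.subset_union_right (s₁ := x.support)) _ (by simp)]
  exact Finset.sum_congr rfl fun t _ => by ring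

theorem diagonalForm_single_right (K : Type*) [Field K] {T : Type*} (σ : T → ℤ) (x : T →₀ K)
    (t : T) : diagonalForm K σ x (Finsupp.single t 1) = σ t * x t := by
  rw [diagonalForm_comm]
  simp [diagonalForm]

theorem SyntaxTree.sign_cast_ne_zero (K : Type*) [Field K] {G : Type} (t : SyntaxTree G) :
    (t.sign : K) ≠ 0 := by
  unfold sign
  split <;> simp

theorem scalarProduct_isRefl (K : Type*) [Field K] (G : Type) :
    LinearMap.BilinForm.IsRefl (scalarProduct K G) :=
  fun x y h => (diagonalForm_comm K _ y x).trans h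

theorem scalarProduct_nondegenerate (K : Type*) [Field K] (G : Type) :
    LinearMap.BilinForm.Nondegenerate (scalarProduct K G) := by
  refine (LinearMap.IsRefl.nondegenerate_iff_separatingLeft (scalarProduct_isRefl K G)).2
    fun x hx => Finsupp.ext fun t => ?_
  have h := (diagonalForm_single_right K _ _ _).symm.trans (hx (t.1.toFree K 3 t.2))
  exact (mul_eq_zero.1 h).resolve_left (t.1.sign_cast_ne_zero K)

instance FreeOperad.finite_obj_three (K : Type*) [Field K] (G : Type) [Finite G] :
    FiniteDimensional K ((FreeOperad K G).obj 3) := by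
  have : Finite {t : SyntaxTree G // t.leaves = 3} := by
    refine Finite.of_surjective (α := (G × G) ⊕ (G × G))
      (Sum.elim (fun p => ⟨.node p.1 (.node p.2 .leaf .leaf) .leaf, rfl⟩)
        (fun p => ⟨.node p.1 .leaf (.node p.2 .leaf .leaf), rfl⟩)) ?_
    rintro ⟨t, ht⟩
    obtain ⟨x, y, rfl | rfl⟩ := SyntaxTree.eq_of_leaves_eq_three ht
    · exact ⟨.inl (x, y), rfl⟩
    · exact ⟨.inr (x, y), rfl⟩
  exact inferInstanceAs (FiniteDimensional K ({t : SyntaxTree G // t.leaves = 3} →₀ K))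

instance PolyGen.finite (γ : ℕ) : Finite (PolyGen γ) :=
  Finite.of_surjective (Sum.elim PolyGen.left PolyGen.right) fun
    | .left a => ⟨.inl a, rfl⟩
    | .right a => ⟨.inr a, rfl⟩

theorem annihilator_annihilator {K : Type*} [Field K] {G : Type} [Finite G]
    (R : Submodule K ((FreeOperad K G).obj 3)) : annihilator (annihilator R) = R :=
  LinearMap.BilinForm.orthogonal_orthogonal (scalarProduct_nondegenerate K G)
    (scalarProduct_isRefl K G) R

/-! ### The Koszul dual of the pluriassociative operad -/

theorem linearCombination_ite_apply (K : Type*) [Field K] {T L : Type*} [DecidableEq L] {f : T → L}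
    (hf : Function.Injective f) (x : T →₀ K) (w : T) :
    Finsupp.linearCombination K (fun t => if f t = f w then (1 : K) else 0) x = x w := by
  classical
  simp [Finsupp.linearCombination_apply, Finsupp.sum, hf.eq_iff, eq_comm]

theorem Dias.eq_zero_of_coeff {K : Type*} [Field K] {γ : ℕ} {y : (Dias K γ).obj 3}
    (h : ∀ c, Dias.coeff K c y = 0) : y = 0 :=
  Finsupp.ext fun w => (linearCombination_ite_apply K
    (List.ofFn_injective.comp Subtype.val_injective) y w).symm.trans (h (List.ofFn w.1))

section

open SyntaxTree FreeOperad PolyGen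

/-- The words `0 x y`, `x 0 y` and `x y 0` correspond to the seven families of relations, according
to the position of `0` and the order of `x` and `y`. -/
theorem exists_dendrRelation (K : Type*) [Field K] {γ : ℕ} (x y : Fin γ) :
    (∃ ρ ∈ dendrRelations K γ, IsWordFunctional K ρ [0, x.succ, y.succ]) ∧
    (∃ ρ ∈ dendrRelations K γ, IsWordFunctional K ρ [x.succ, 0, y.succ]) ∧
    ∃ ρ ∈ dendrRelations K γ, IsWordFunctional K ρ [x.succ, y.succ, 0] := by
  refine ⟨?_, ⟨_, Submodule.subset_span ?_, IsWordFunctional.left_right K y x⟩, ?_⟩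
  · rcases lt_trichotomy x y with h | rfl | h
    · exact ⟨_, Submodule.subset_span (.inl (.inl (.inl (.inr ⟨x, y, h, rfl⟩)))),
        IsWordFunctional.left_left_of_gt K h⟩
    · exact ⟨_, Submodule.subset_span (.inl (.inr ⟨x, rfl⟩)), IsWordFunctional.left_left_self K x⟩
    · exact ⟨_, Submodule.subset_span (.inl (.inl (.inl (.inl (.inl (.inr ⟨y, x, h, rfl⟩)))))),
        IsWordFunctional.left_left_of_lt K h⟩
  · exact .inl (.inl (.inl (.inl (.inl (.inl ⟨y, x, rfl⟩)))))
  · rcases lt_trichotomy x y with h | rfl | h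
    · exact ⟨_, Submodule.subset_span (.inl (.inl (.inl (.inl (.inr ⟨x, y, h, rfl⟩))))),
        IsWordFunctional.right_left_of_lt K h⟩
    · exact ⟨_, Submodule.subset_span (.inr ⟨x, rfl⟩), IsWordFunctional.right_right_self K x⟩
    · exact ⟨_, Submodule.subset_span (.inl (.inl (.inr ⟨y, x, h, rfl⟩))),
        IsWordFunctional.right_right_of_gt K h⟩

theorem exists_dendrRelation_code (K : Type*) [Field K] {γ : ℕ} {t : SyntaxTree (PolyGen γ)}
    (ht : t.leaves = 3) : ∃ ρ ∈ dendrRelations K γ, IsWordFunctional K ρ t.code := by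
  obtain ⟨x | x, y | y, rfl | rfl⟩ := SyntaxTree.eq_of_leaves_eq_three ht <;>
    simp only [code, List.map_cons, List.map_nil, List.cons_append, List.nil_append,
      ← Fin.succ_max_succ, max_eq_left (Fin.zero_le _)]
  · exact (exists_dendrRelation K y x).1
  · exact (exists_dendrRelation K x (max x y)).1
  · exact (exists_dendrRelation K y x).2.1
  · exact (exists_dendrRelation K (max x y) x).1
  · exact (exists_dendrRelation K x (max x y)).2.2
  · exact (exists_dendrRelation K x y).2.1
  · exact (exists_dendrRelation K (max x y) x).2.2
  · exact (exists_dendrRelation K x y).2.2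

end

/-- The pairings with the relations spanning `dendrRelations` are the coefficients of the words in
the value in `Dias`, so they all vanish exactly on the kernel. -/
theorem annihilator_dendrRelations (K : Type*) [Field K] (γ : ℕ) :
    annihilator (dendrRelations K γ) = relationSpace (Dias K γ) (Dias.gen K) := by
  refine le_antisymm (fun r hr => LinearMap.mem_ker.2 (Dias.eq_zero_of_coeff fun c => ?_))
    fun r hr ρ hρ => ?_
  · by_cases hc : ∃ t : SyntaxTree (PolyGen γ), t.leaves = 3 ∧ t.code = c
    · obtain ⟨t, ht, rfl⟩ := hc
      obtain ⟨ρ, hρ, h⟩ := exists_dendrRelation_code K ht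
      rw [← h.scalarProduct_eq]
      exact hr ρ hρ
    · have e : Dias.coeff K c ∘ₗ (FreeOperad.lift (Dias K γ) (Dias.gen K)).map 3 = 0 := by
        refine FreeOperad.hom_ext_obj fun t ht => ?_
        rw [LinearMap.comp_apply, FreeOperad.lift_toFree, Dias.coeff_eval,
          if_neg fun h => hc ⟨t, ht, h⟩, LinearMap.zero_apply]
      exact LinearMap.congr_fun e r
  · induction hρ using Submodule.span_induction with
    | mem ρ hρ =>
      have hc : ∃ c, IsWordFunctional K ρ c := by
        rcases hρ with (((((⟨a, b, rfl⟩ | ⟨a, b, h, rfl⟩) | ⟨a, b, h, rfl⟩) | ⟨a, b, h, rfl⟩) |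
          ⟨a, b, h, rfl⟩) | ⟨d, rfl⟩) | ⟨d, rfl⟩
        · exact ⟨_, IsWordFunctional.left_right K a b⟩
        · exact ⟨_, IsWordFunctional.left_left_of_lt K h⟩
        · exact ⟨_, IsWordFunctional.right_left_of_lt K h⟩
        · exact ⟨_, IsWordFunctional.left_left_of_gt K h⟩
        · exact ⟨_, IsWordFunctional.right_right_of_gt K h⟩
        · exact ⟨_, IsWordFunctional.left_left_self K d⟩
        · exact ⟨_, IsWordFunctional.right_right_self K d⟩
      obtain ⟨c, h⟩ := hc
      rw [h.scalarProduct_eq, LinearMap.mem_ker.1 hr, map_zero]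
    | zero => rw [map_zero, LinearMap.zero_apply]
    | add x y _ _ hx hy => rw [map_add, LinearMap.add_apply, hx, hy, add_zero]
    | smul c x _ hx => rw [map_smul, LinearMap.smul_apply, hx, smul_zero]

theorem mainTheorem1 (K : Type*) [Field K] [CharZero K] (γ : ℕ) :
    IsPresentation (Dias K γ) (Dias.gen K) (relationSpace (Dias K γ) (Dias.gen K)) ∧
    annihilator (relationSpace (Dias K γ) (Dias.gen K)) = dendrRelations K γ ∧
    ∀ (P : NSOperad K) (b : PolyGen γ → P.obj 2),
      IsKoszulDual (Dias K γ) (Dias.gen K) P b ↔ IsPresentation P b (dendrRelations K γ) := by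
  have hann : annihilator (relationSpace (Dias K γ) (Dias.gen K)) = dendrRelations K γ := by
    rw [← annihilator_dendrRelations, annihilator_annihilator]
  refine ⟨Dias.isPresentation K γ, hann, fun P b => ⟨?_, fun h => ?_⟩⟩
  · rintro ⟨R, hR, hP⟩
    rwa [hR.eq_relationSpace, hann] at hP
  · exact ⟨_, Dias.isPresentation K γ, hann.symm ▸ h⟩
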